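/- Conventions. For a separable complex Hilbert space $M$ let $E_M=\mathbb C\eta_1\oplus\mathbb C\eta_2\oplus M$ carry the form $Q$ (linear in the first, antilinear in the second argument) with $Q(\eta_i,\eta_i)=0$, $Q(\eta_1,\eta_2)=1$, $Q(\eta_i,M)=0$ and $Q|_M=-\langle\cdot,\cdot\rangle_M$. The complex hyperbolic space $\mathbf H(E_M)$ is the set of $Q$-positive lines with $\cosh d([v],[w])=|Q(v,w)|\,Q(v,v)^{-1/2}Q(w,w)^{-1/2}$, its boundary is the set of isotropic lines, and $PU(Q)$, the image of the group $U(Q)$ of $Q$-preserving linear automorphisms in the transformations of the projective space, is its group of holomorphic isometries. In an isotropic basis of $\mathbb C^{1,1}$ put, for $\lambda>0$ and $b\in\mathbb R$, $g(\lambda,b)=\begin{pmatrix}\lambda& ib\\0&\lambda^{-1}\end{pmatrix}$, $s=\begin{pmatrix}0&i\\ i&0\end{pmatrix}\in SU(1,1)$, and $P=\{g(\lambda,b)\}$. A representation is a homomorphism $\rho:PSU(1,1)\to PU(Q)$; it is orbitally continuous if $g\mapsto\rho(g)x$ is continuous for each $x\in\mathbf H(E_M)$; it is irreducible if it fixes no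 point of $\mathbf H(E_M)\cup\partial\mathbf H(E_M)$, preserves no pair of boundary points, and leaves no proper complex hyperbolic subspace invariant. It has distinguished boundary points $[\eta_1],[\eta_2]$ if $\rho(P)$ fixes $[\eta_1]$ and all $\rho(g(\lambda,0))$ fix $[\eta_2]$. In that case write $\rho(\lambda,b)\in U(Q)$ for the linear representative of $\rho(g(\lambda,b))$ with $Q(\rho(\lambda,b)\eta_1,\eta_2)>0$, let $\pi(\lambda,b)$ be its block on $M$, $c(b)$ the $M$-component and $\Delta(b)$ the imaginary part of the $\eta_1$-component of $\rho(1,b)\eta_2$, and $K(b)=\tfrac12\|c(b)\|^2+i\Delta(b)$. The length $\ell(\rho)$ is the real number $t$ with $\rho(\lambda,0)\eta_1=\lambda^t\eta_1$ for all $\lambda>0$, and $\operatorname{Arg}(\rho)=\operatorname{Arg}(K(1))$. Theorem. Let $L$ be an infinite-dimensional separable complex Hilbert space and let $\rho_1,\rho_2$ be orbitally continuous irreducible representations of $PSU(1,1)$ into $PU(Q)$ on $E_L$, both with distinguished boundary points $[\eta_1],[\eta_2]$ and with $\ell(\rho_1)=\ell(\rho_2)=t$. Let $c_i,\pi_i,\Delta_i,K_i$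 be the data of $\rho_i$, and put $c=c_1\oplus c_2$, $\pi=\pi_1\oplus\pi_2$, $\Delta=\Delta_1+\Delta_2$, $K(b)=\tfrac12\|c(b)\|^2+i\Delta(b)$, and $L'=\overline{\operatorname{span}}\{c(b):b\in\mathbb R\}\subseteq L\oplus L$. Then $K(1)\neq0$, $L'$ is infinite-dimensional, and, with $\nu=|K(1)|^{-1}$ (so that $\nu=1$ under the normalisation $|K(1)|=1$): (1) there is a unitary involution $A$ of $L'$ with $Ac(b)=\nu K(b)\,c(-1/b)$ for all $b\neq0$; (2) there is a homomorphism $T:SU(1,1)\to PU(Q)$ on $E_{L'}$ such that, in blocks with respect to $\mathbb C\eta_1\oplus\mathbb C\eta_2\oplus L'$, for all $\lambda>0$, $b\in\mathbb R$, the isometries $T(g(\lambda,0))$, $T(g(1,b))$, $T(s)$ are represented respectively by $$\begin{pmatrix}\lambda^t&0&0\\0&\lambda^{-t}&0\\0&0&\pi(\lambda,0)\end{pmatrix},\qquad \begin{pmatrix}1&K(b)&\langle\pi(1,b)\,\cdot\,,c(b)\rangle\\0&1&0\\0&c(b)&\pi(1,b)\end{pmatrix},\qquad \begin{pmatrix}0&\nu^{-1}&0\\\nu&0&0\\0&0&A\end{pmatrix},$$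 where $\langle\cdot,\cdot\rangle$ is the (positive definite) inner product of $L\oplus L$, linear in the first argument; (3) $T$ factors through a representation $\rho$ of $PSU(1,1)$ that is irreducible and orbitally continuous, has distinguished boundary points $[\eta_1],[\eta_2]$, and satisfies $\ell(\rho)=t$ and $\operatorname{Arg}(\rho)=\operatorname{Arg}(K_1(1)+K_2(1))$. -/

import Mathlib

open scoped LinearAlgebra.Projectivization Topology

namespace Horo

noncomputable section

/-! ### The group `SU(1,1)` in an isotropic basis, and `PSU(1,1)` -/

/-- The Gram matrix of the form of signature `(1,1)` in an isotropic basis `ξ₁, ξ₂` with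
`B(ξ₁, ξ₂) = 1`. -/
def gram11 : Matrix (Fin 2) (Fin 2) ℂ := !![0, 1; 1, 0]

/-- `SU(1,1)`, written in the basis `ξ₁, ξ₂`, with the topology of `SL₂(ℂ)`. -/
def SU11 : Subgroup (Matrix.SpecialLinearGroup (Fin 2) ℂ) where
  carrier := {g | g.1.conjTranspose * gram11 * g.1 = gram11}
  one_mem' := by simp
  mul_mem' := by
    intro a b ha hb
    simp only [Set.mem_ofPred_eq] at ha hb ⊢
    rw [Matrix.SpecialLinearGroup.coe_mul, Matrix.conjTranspose_mul]
    calc _ = b.1.conjTranspose * (a.1.conjTranspose * gram11 * a.1) * b.1 := by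
            simp only [Matrix.mul_assoc]
      _ = _ := by rw [ha, hb]
  inv_mem' := by
    intro a ha
    simp only [Set.mem_ofPred_eq] at ha ⊢
    have h1 : a.1 * (a⁻¹).1 = 1 := by
      rw [← Matrix.SpecialLinearGroup.coe_mul, mul_inv_cancel,
        Matrix.SpecialLinearGroup.coe_one]
    have h2 : (a⁻¹).1.conjTranspose * a.1.conjTranspose = 1 := by
      rw [← Matrix.conjTranspose_mul, h1, Matrix.conjTranspose_one]
    calc (a⁻¹).1.conjTranspose * gram11 * (a⁻¹).1
        = (a⁻¹).1.conjTranspose * (a.1.conjTranspose * gram11 * a.1) * (a⁻¹).1 := by rw [ha]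
      _ = ((a⁻¹).1.conjTranspose * a.1.conjTranspose) * gram11 * (a.1 * (a⁻¹).1) := by
            simp only [Matrix.mul_assoc]
      _ = gram11 := by rw [h1, h2]; simp

/-- The group of holomorphic isometries of the complex hyperbolic line, `PSU(1,1)`, with the
quotient topology. -/
abbrev PSU11 : Type := SU11 ⧸ Subgroup.center SU11

/-- The element `g(l, b) = [[l, ib], [0, l⁻¹]]` (with `l > 0`) of the parabolic subgroup `P`. -/
def gP (l : ℝ) (hl : 0 < l) (b : ℝ) : SU11 :=
  ⟨⟨!![(l : ℂ), Complex.I * b; 0, (l : ℂ)⁻¹], by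
      have : (l : ℂ) ≠ 0 := by exact_mod_cast hl.ne'
      simp [Matrix.det_fin_two, this]⟩, by
    have : (l : ℂ) ≠ 0 := by exact_mod_cast hl.ne'
    change Matrix.conjTranspose _ * gram11 * _ = gram11
    ext i j
    fin_cases i <;> fin_cases j <;>
      simp [gram11, Matrix.mul_apply, Fin.sum_univ_two, this] <;> ring⟩

/-- The element `s = [[0, i], [i, 0]]`. -/
def sElt : SU11 :=
  ⟨⟨!![0, Complex.I; Complex.I, 0], by simp [Matrix.det_fin_two]⟩, by
    change Matrix.conjTranspose _ * gram11 * _ = gram11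
    ext i j
    fin_cases i <;> fin_cases j <;>
      simp [gram11, Matrix.mul_apply, Fin.sum_univ_two]⟩

/-- The projection `SU(1,1) → PSU(1,1)`. -/
def toPSU : SU11 →* PSU11 := QuotientGroup.mk' (Subgroup.center SU11)

/-! ### The hyperbolic space with two marked boundary points

For a complex Hilbert space `M`, the space `ℂη₁ ⊕ ℂη₂ ⊕ M` carries the form `Q` of signature
`(1, 1 + dim M)` for which `η₁, η₂` are isotropic, `Q(η₁, η₂) = 1`, and which is the opposite of
the inner product on `M = η₁^⊥ ∩ η₂^⊥`. -/

/-- The space `ℂη₁ ⊕ ℂη₂ ⊕ M`. -/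
abbrev Model (M : Type*) : Type _ := ℂ × ℂ × M

section Model

variable {M : Type*} [NormedAddCommGroup M] [InnerProductSpace ℂ M]

/-- The form, linear in the first argument and antilinear in the second one (recall that
`inner ℂ x y` is linear in `y`). -/
def Q (v w : Model M) : ℂ :=
  v.1 * star w.2.1 + v.2.1 * star w.1 - inner ℂ w.2.2 v.2.2

variable (M) in
/-- The isotropic vector `η₁`. -/
def eta1 : Model M := (1, 0, 0)

variable (M) in
/-- The isotropic vector `η₂`. -/
def eta2 : Model M := (0, 1, 0)

theorem eta1_ne_zero : eta1 M ≠ 0 := by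
  simp [eta1, Prod.ext_iff]

theorem eta2_ne_zero : eta2 M ≠ 0 := by
  simp [eta2, Prod.ext_iff]

variable (M) in
/-- The boundary point `[η₁]`. -/
def pt1 : ℙ ℂ (Model M) := Projectivization.mk ℂ (eta1 M) eta1_ne_zero

variable (M) in
/-- The boundary point `[η₂]`. -/
def pt2 : ℙ ℂ (Model M) := Projectivization.mk ℂ (eta2 M) eta2_ne_zero

variable (M) in
/-- The complex hyperbolic space of `(ℂη₁ ⊕ ℂη₂ ⊕ M, Q)`: the positive lines. -/
def hypSpace : Set (ℙ ℂ (Model M)) := {p | 0 < (Q p.rep p.rep).re}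

variable (M) in
/-- Its boundary at infinity: the isotropic lines. -/
def hypBoundary : Set (ℙ ℂ (Model M)) := {p | Q p.rep p.rep = 0}

/-- The hyperbolic distance, `cosh d([v],[w]) = |Q(v,w)| / (Q(v,v)^{1/2} Q(w,w)^{1/2})`. -/
def hypDist (p q : ℙ ℂ (Model M)) : ℝ :=
  Real.arcosh (‖Q p.rep q.rep‖ / (√(Q p.rep p.rep).re * √(Q q.rep q.rep).re))

variable (M) in
/-- The group `U(Q)` of linear automorphisms that preserve `Q`. -/
def UQ : Subgroup (Model M ≃ₗ[ℂ] Model M) where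
  carrier := {S | ∀ v w, Q (S v) (S w) = Q v w}
  one_mem' := fun _ _ => rfl
  mul_mem' := by
    intro a b ha hb v w
    rw [LinearEquiv.mul_apply, LinearEquiv.mul_apply, ha, hb]
  inv_mem' := by
    intro a ha v w
    rw [← ha (a⁻¹ v) (a⁻¹ w), ← LinearEquiv.mul_apply, ← LinearEquiv.mul_apply, mul_inv_cancel]
    rfl

variable (M) in
/-- The group `PU(Q)` of holomorphic isometries of the hyperbolic space: the image of `U(Q)` in
the group of transformations of the projective space. -/
def PUQ : Subgroup (Equiv.Perm (ℙ ℂ (Model M))) :=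
  (UQ M).map (MulAction.toPermHom (Model M ≃ₗ[ℂ] Model M) (ℙ ℂ (Model M)))

/-- The isometry `x` is represented by the linear map `f`. -/
def IsRepresentedBy (x : PUQ M) (f : Model M → Model M) : Prop :=
  ∃ S ∈ UQ M, MulAction.toPermHom (Model M ≃ₗ[ℂ] Model M) (ℙ ℂ (Model M)) S = x.1 ∧
    ∀ v, S v = f v

/-! ### Representations -/

/-- Orbital continuity: for each point `p` of the hyperbolic space, `g ↦ ρ(g)p` is continuous for
the hyperbolic distance. -/
def OrbContinuous (ρ : PSU11 →* PUQ M) : Prop :=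
  ∀ p ∈ hypSpace M, ∀ g₀ : PSU11,
    Filter.Tendsto (fun g : PSU11 => hypDist ((ρ g).1 p) ((ρ g₀).1 p)) (𝓝 g₀) (𝓝 0)

/-- No fixed point in the hyperbolic space or its boundary, and no preserved pair of boundary
points. -/
def NonElementary (ρ : PSU11 →* PUQ M) : Prop :=
  (¬ ∃ p ∈ hypSpace M ∪ hypBoundary M, ∀ g, (ρ g).1 p = p) ∧
  ¬ ∃ p ∈ hypBoundary M, ∃ q ∈ hypBoundary M, p ≠ q ∧
      ∀ g, ((ρ g).1 p = p ∧ (ρ g).1 q = q) ∨ ((ρ g).1 p = q ∧ (ρ g).1 q = p)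

/-- The closed subspace `V` defines a complex hyperbolic subspace. Since `Q` has exactly one
positive direction, it is enough that `V` contains a positive vector: the restriction of `Q` is
then non-degenerate, of signature `(1, m')`. -/
def IsHyperbolicSubspace (V : Submodule ℂ (Model M)) : Prop :=
  IsClosed (V : Set (Model M)) ∧ ∃ v ∈ V, 0 < (Q v v).re

/-- Non-elementary, without proper invariant complex hyperbolic subspace. -/
def IsIrreducibleRep (ρ : PSU11 →* PUQ M) : Prop :=
  NonElementary ρ ∧
  ∀ V : Submodule ℂ (Model M), IsHyperbolicSubspace V →
    (∀ g, ∀ p ∈ hypSpace M, p.rep ∈ V → ((ρ g).1 p).rep ∈ V) → V = ⊤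

/-- `[η₁]` and `[η₂]` are the distinguished boundary points of `ρ`: `ρ(P)` fixes `[η₁]` and the
isometries `ρ(g(l,0))` fix `[η₂]`. -/
def HasDistinguishedPoints (ρ : PSU11 →* PUQ M) : Prop :=
  (∀ (l : ℝ) (hl : 0 < l) (b : ℝ), (ρ (toPSU (gP l hl b))).1 (pt1 M) = pt1 M) ∧
  ∀ (l : ℝ) (hl : 0 < l), (ρ (toPSU (gP l hl 0))).1 (pt2 M) = pt2 M

/-- Some linear representative of an isometry. -/
def someLift (x : PUQ M) : Model M ≃ₗ[ℂ] Model M := x.2.choose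

/-- The linear representative `S` of an isometry fixing `[η₁]` that is normalised by the condition
`Q(S η₁, η₂) > 0`. -/
def normLift (x : PUQ M) (v : Model M) : Model M :=
  (star (Q (someLift x (eta1 M)) (eta2 M)) / (‖Q (someLift x (eta1 M)) (eta2 M)‖ : ℂ)) •
    someLift x v

/-- `ρ` has length `t`: the normalised representative of `ρ(g(l,0))` multiplies `η₁` by `l^t`. -/
def HasLength (ρ : PSU11 →* PUQ M) (t : ℝ) : Prop :=
  ∀ (l : ℝ) (hl : 0 < l),
    normLift (ρ (toPSU (gP l hl 0))) (eta1 M) = ((l ^ t : ℝ) : ℂ) • eta1 M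

/-- `c(b)`: the `M`-component of the image of `η₂` under (the normalised representative of)
`ρ(g(1,b))`. -/
def cocyc (ρ : PSU11 →* PUQ M) (b : ℝ) : M :=
  (normLift (ρ (toPSU (gP 1 one_pos b))) (eta2 M)).2.2

/-- `Δ(b)`: the imaginary part of the `η₁`-component of the image of `η₂` under `ρ(g(1,b))`. -/
def delta (ρ : PSU11 →* PUQ M) (b : ℝ) : ℝ :=
  (normLift (ρ (toPSU (gP 1 one_pos b))) (eta2 M)).1.im

/-- `π(l,b)`: the `M`-block of `ρ(g(l,b))`. -/
def unitaryPart (ρ : PSU11 →* PUQ M) (l : ℝ) (hl : 0 < l) (b : ℝ) (u : M) : M :=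
  (normLift (ρ (toPSU (gP l hl b))) (0, 0, u)).2.2

/-- `K(b) = -Q(c(b), c(b)) / 2 + i Δ(b)`, where `Q(c, c) = -‖c‖²`. -/
def Kfun (ρ : PSU11 →* PUQ M) (b : ℝ) : ℂ :=
  (‖cocyc ρ b‖ ^ 2 / 2 : ℝ) + Complex.I * (delta ρ b : ℂ)

/-- The angular invariant `Arg(ρ) = Arg(K(1))`. -/
def angularInvariant (ρ : PSU11 →* PUQ M) : ℝ := (Kfun ρ 1).arg

/-! ### Block maps on `ℂη₁ ⊕ ℂη₂ ⊕ M` -/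

/-- The block matrix `diag(χ, χ⁻¹, π)`. -/
def diagBlock (χ : ℝ) (π : M → M) (v : Model M) : Model M :=
  (χ * v.1, (χ : ℂ)⁻¹ * v.2.1, π v.2.2)

/-- The block matrix with rows `(1, k, -Q(π ·, c))`, `(0, 1, 0)`, `(0, c, π)`. -/
def unipBlock (k : ℂ) (c : M) (π : M → M) (v : Model M) : Model M :=
  (v.1 + k * v.2.1 + inner ℂ c (π v.2.2), v.2.1, v.2.1 • c + π v.2.2)

/-- The block matrix with rows `(0, ν⁻¹, 0)`, `(ν, 0, 0)`, `(0, 0, A)`. -/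
def swapBlock (ν : ℝ) (A : M → M) (v : Model M) : Model M :=
  ((ν : ℂ)⁻¹ * v.2.1, ν * v.1, A v.2.2)

end Model

/-! ### The combination of the parabolic data of two representations -/

section Combination

variable {M : Type*} [NormedAddCommGroup M] [InnerProductSpace ℂ M]

/-- `c(b) = c₁(b) ⊕ c₂(b)` in the Hilbert sum `M ⊕ M`. -/
def combC (ρ₁ ρ₂ : PSU11 →* PUQ M) (b : ℝ) : WithLp 2 (M × M) :=
  WithLp.toLp 2 (cocyc ρ₁ b, cocyc ρ₂ b)

/-- `π(l,b) = π₁(l,b) ⊕ π₂(l,b)`. -/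
def combPi (ρ₁ ρ₂ : PSU11 →* PUQ M) (l : ℝ) (hl : 0 < l) (b : ℝ) (w : WithLp 2 (M × M)) :
    WithLp 2 (M × M) :=
  WithLp.toLp 2 (unitaryPart ρ₁ l hl b w.fst, unitaryPart ρ₂ l hl b w.snd)

/-- `K(b) = -Q(c(b), c(b)) / 2 + i (Δ₁(b) + Δ₂(b))`. -/
def combK (ρ₁ ρ₂ : PSU11 →* PUQ M) (b : ℝ) : ℂ :=
  (‖combC ρ₁ ρ₂ b‖ ^ 2 / 2 : ℝ) + Complex.I * ((delta ρ₁ b + delta ρ₂ b : ℝ) : ℂ)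

/-- The closed linear span `L'` of the vectors `c(b)`. -/
def combSpace (ρ₁ ρ₂ : PSU11 →* PUQ M) : Submodule ℂ (WithLp 2 (M × M)) :=
  (Submodule.span ℂ (Set.range (combC ρ₁ ρ₂))).topologicalClosure

/-- `c(b)` as a vector of `L'`. -/
def combC' (ρ₁ ρ₂ : PSU11 →* PUQ M) (b : ℝ) : combSpace ρ₁ ρ₂ :=
  ⟨combC ρ₁ ρ₂ b, Submodule.le_topologicalClosure _ (Submodule.subset_span ⟨b, rfl⟩)⟩

/-- The inclusion `ℂη₁ ⊕ ℂη₂ ⊕ L' → ℂη₁ ⊕ ℂη₂ ⊕ (M ⊕ M)`. -/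
def combIncl (ρ₁ ρ₂ : PSU11 →* PUQ M) (v : Model (combSpace ρ₁ ρ₂)) :
    Model (WithLp 2 (M × M)) :=
  (v.1, v.2.1, (v.2.2 : WithLp 2 (M × M)))

/-- The isometry `x` of the hyperbolic space of `ℂη₁ ⊕ ℂη₂ ⊕ L'` is represented by the
restriction of the map `f` of `ℂη₁ ⊕ ℂη₂ ⊕ (M ⊕ M)`. -/
def IsRepresentedByRestriction (ρ₁ ρ₂ : PSU11 →* PUQ M) (x : PUQ (combSpace ρ₁ ρ₂))
    (f : Model (WithLp 2 (M × M)) → Model (WithLp 2 (M × M))) : Prop :=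
  ∃ f' : Model (combSpace ρ₁ ρ₂) → Model (combSpace ρ₁ ρ₂),
    IsRepresentedBy x f' ∧ ∀ v, combIncl ρ₁ ρ₂ (f' v) = f (combIncl ρ₁ ρ₂ v)

end Combination

end

end Horo

open Horo

/-!
Write `K_i(x)` for the function attached to `ρ_i` and `v_b = K_i(b)η₁ + η₂ + c_i(b)` for the image
of `η₂` under the normalised representative of `ρ_i(g(1,b))`. Two facts about the parabolic data
make the combination possible.

*The data are governed by one complex number.* Conjugation by `g(l,0)` gives `K(l²b) = l^{2t}K(b)`,
and `K(-b)` is the conjugate of `K(b)`; hence `K(x) = |x|^t κ` for `x ≥ 0` and `|x|^t κ̄` for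
`x < 0`, with `κ = K(1)` (`Kfun_eq_kerK`). Since `Q(v_a, v_b) = K(a - b)`, the Gram matrix of the
cocycle is `⟨c(a), c(b)⟩ = K(a) + K(-b) - K(a - b)`. All this is additive in `K`, hence passes to
`c₁ ⊕ c₂`, with `κ = κ₁ + κ₂`. For an irreducible representation moreover `t > 0`, `Re κ > 0` and the
vectors `c(b)` are total (`isHoroCocycle_cocyc`):

* orbital continuity gives `K(b) → 0` as `b → 0`, so that `K = 0` unless `t > 0`;
* if `t = 0`, then `P` fixes `[η₁ + η₂]`, and since the double coset `PsP` accumulates at the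
  identity, `ρ(s)` fixes it as well, against irreducibility (`length_ne_zero`);
* if `t ≠ 0`, then `ρ(s)` exchanges `[η₁]` and `[η₂]`, so the points `[η₁]` and `[v_b]` form an orbit
  of `ρ`, their span is invariant, and irreducibility makes the `c(b)` total
  (`total_of_irreducible`).

*Conversely, such a family defines a representation.* Let `c` be a total family with the above Gram
matrix (`IsHoroCocycle`). Two total families with the same Gram matrix differ by a unitary operator
(`exists_isometry_of_gram`). This yields the unitary parts of the parabolic isometries, from
`π(1,b)c(a) = c(a+b) - c(b)` and `π(l,0)c(a) = l^{-t}c(l²a)`, and the involution `A`, from the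
functional equation `K(a)K(-b)K(1/b - 1/a) = |κ|²K(a - b)` (`kerK_mul_mul`). The block isometries built
from them map the points `[η₁]`, `[v_b]` to each other as the elements `g(l,0)`, `g(1,b)`, `s` do on
the boundary `P¹(ℝ)` of the complex hyperbolic line. As these elements generate `SU(1,1)` and an
isometry is determined by its effect on those points (`equivariant_unique`), the relations of the
group need not be checked: sending `g` to the unique isometry that acts like `g` on the points is a
homomorphism, trivial on the centre (`exists_rep`).

The resulting representation is irreducible, because the contraction by the diagonal isometries puts
`η₁`, `η₂`, and then every `c(b)`, into any invariant hyperbolic subspace; it is orbitally continuous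
because `‖c(a) - c(b)‖² = 2|a - b|^t Re κ`, and near the identity the group elements are products of
`s` and of elements of `P` whose parameters depend continuously on them.
-/

namespace Horo

/-! ### Structure of `SU(1,1)` -/

/-- The matrix entries of an element of `SU(1,1)`. -/
def entry (g : SU11) (i j : Fin 2) : ℂ := g.1.1 i j

theorem SU11_ext {g h : SU11} (h00 : entry g 0 0 = entry h 0 0) (h01 : entry g 0 1 = entry h 0 1)
    (h10 : entry g 1 0 = entry h 1 0) (h11 : entry g 1 1 = entry h 1 1) : g = h := by
  apply Subtype.ext
  apply Subtype.ext
  ext i j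
  fin_cases i <;> fin_cases j <;> assumption

theorem entry_mul (g h : SU11) (i j : Fin 2) :
    entry (g * h) i j = entry g i 0 * entry h 0 j + entry g i 1 * entry h 1 j := by
  simp [entry, Matrix.mul_apply, Fin.sum_univ_two]

theorem entry_one (i j : Fin 2) : entry 1 i j = if i = j then 1 else 0 := by
  simp [entry, Matrix.one_apply]

theorem entry_det (g : SU11) : entry g 0 0 * entry g 1 1 - entry g 0 1 * entry g 1 0 = 1 := by
  have h := g.1.2
  rwa [Matrix.det_fin_two] at h

section gP
variable (l : ℝ) (hl : 0 < l) (b : ℝ)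
@[simp] theorem gP_00 : entry (gP l hl b) 0 0 = l := by simp [entry, gP]
@[simp] theorem gP_01 : entry (gP l hl b) 0 1 = Complex.I * b := by simp [entry, gP]
@[simp] theorem gP_10 : entry (gP l hl b) 1 0 = 0 := by simp [entry, gP]
@[simp] theorem gP_11 : entry (gP l hl b) 1 1 = (l : ℂ)⁻¹ := by simp [entry, gP]
end gP
@[simp] theorem sElt_00 : entry sElt 0 0 = 0 := by simp [entry, sElt]
@[simp] theorem sElt_01 : entry sElt 0 1 = Complex.I := by simp [entry, sElt]
@[simp] theorem sElt_10 : entry sElt 1 0 = Complex.I := by simp [entry, sElt]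
@[simp] theorem sElt_11 : entry sElt 1 1 = 0 := by simp [entry, sElt]

/-- The matrices of `SU(1,1)` in an isotropic basis have real diagonal and imaginary antidiagonal,
because `g⁻¹ = J g* J`. -/
theorem exists_entries (g : SU11) : ∃ a b c d : ℝ, entry g 0 0 = a ∧ entry g 0 1 = Complex.I * b ∧
    entry g 1 0 = Complex.I * c ∧ entry g 1 1 = d ∧ a * d + b * c = 1 := by
  have h : g.1.1.conjTranspose * gram11 * g.1.1 = gram11 := g.2
  have e (i j : Fin 2) := congrFun (congrFun h i) j
  have e00 : star (entry g 1 0) * entry g 0 0 + star (entry g 0 0) * entry g 1 0 = 0 := by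
    simpa [entry, gram11, Matrix.mul_apply, Fin.sum_univ_two] using e 0 0
  have e01 : star (entry g 1 0) * entry g 0 1 + star (entry g 0 0) * entry g 1 1 = 1 := by
    simpa [entry, gram11, Matrix.mul_apply, Fin.sum_univ_two] using e 0 1
  have e10 : star (entry g 1 1) * entry g 0 0 + star (entry g 0 1) * entry g 1 0 = 1 := by
    simpa [entry, gram11, Matrix.mul_apply, Fin.sum_univ_two] using e 1 0
  have e11 : star (entry g 1 1) * entry g 0 1 + star (entry g 0 1) * entry g 1 1 = 0 := by
    simpa [entry, gram11, Matrix.mul_apply, Fin.sum_univ_two] using e 1 1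
  have hd := entry_det g
  generalize entry g 0 0 = p at *
  generalize entry g 0 1 = q at *
  generalize entry g 1 0 = r at *
  generalize entry g 1 1 = s at *
  rw [Complex.star_def] at *
  -- `p̄ = p`, `s̄ = s`, `q̄ = -q`, `r̄ = -r`
  have hp : (starRingEnd ℂ) p = p := by
    linear_combination (-(starRingEnd ℂ) p) * hd + p * e01 - q * e00
  have hs : (starRingEnd ℂ) s = s := by
    linear_combination (-(starRingEnd ℂ) s) * hd + s * e10 - r * e11
  have hq : (starRingEnd ℂ) q = -q := by
    linear_combination (-(starRingEnd ℂ) q) * hd + p * e11 - q * e10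
  have hr : (starRingEnd ℂ) r = -r := by
    linear_combination (-(starRingEnd ℂ) r) * hd + s * e00 - r * e01
  refine ⟨p.re, q.im, r.im, s.re, (Complex.conj_eq_iff_re.1 hp).symm, ?_, ?_,
    (Complex.conj_eq_iff_re.1 hs).symm, ?_⟩
  · have := congrArg Complex.re hq
    simp at this
    apply Complex.ext <;> simp; linarith
  · have := congrArg Complex.re hr
    simp at this
    apply Complex.ext <;> simp; linarith
  · have hp' := congrArg Complex.im hp
    have hs' := congrArg Complex.im hs
    have hq' := congrArg Complex.re hq
    have hr' := congrArg Complex.re hr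
    simp at hp' hs' hq' hr'
    have hq0 : q.re = 0 := by linarith
    have hp0 : p.im = 0 := by linarith
    have := congrArg Complex.re hd
    simp [hq0, hp0] at this
    linarith

theorem gP_mul (l m : ℝ) (hl : 0 < l) (hm : 0 < m) (b c : ℝ) :
    gP l hl b * gP m hm c = gP (l * m) (mul_pos hl hm) (l * c + b / m) := by
  apply SU11_ext <;> simp only [entry_mul, gP_00, gP_01, gP_10, gP_11] <;> push_cast <;> ring

theorem gP_one_zero : gP 1 one_pos 0 = 1 := by
  apply SU11_ext <;> simp [entry_one]

theorem gP_congr {l m : ℝ} (hl : 0 < l) (hm : 0 < m) (b c : ℝ) (h : l = m) (h' : b = c) :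
    gP l hl b = gP m hm c := by
  subst h; subst h'; rfl

theorem gP_unip_mul (b c : ℝ) :
    gP 1 one_pos b * gP 1 one_pos c = gP 1 one_pos (b + c) := by
  rw [gP_mul]; exact gP_congr _ _ _ _ (by simp) (by ring)

theorem gP_diag_mul (l m : ℝ) (hl : 0 < l) (hm : 0 < m) :
    gP l hl 0 * gP m hm 0 = gP (l * m) (mul_pos hl hm) 0 := by
  rw [gP_mul]; exact gP_congr _ _ _ _ rfl (by simp)

theorem gP_eq_unip_mul_diag (l : ℝ) (hl : 0 < l) (b : ℝ) :
    gP l hl b = gP 1 one_pos (l * b) * gP l hl 0 := by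
  rw [gP_mul]; exact gP_congr _ _ _ _ (by simp) (by field_simp; simp)

theorem gP_diag_mul_unip (l : ℝ) (hl : 0 < l) (b : ℝ) :
    gP l hl 0 * gP 1 one_pos b = gP 1 one_pos (l ^ 2 * b) * gP l hl 0 := by
  rw [gP_mul, gP_mul]; exact gP_congr _ _ _ _ (by simp) (by field_simp; simp)

/-- Conjugation by `s` inverts the diagonal elements. -/
theorem sElt_mul_diag (l : ℝ) (hl : 0 < l) :
    sElt * gP l hl 0 = gP l⁻¹ (inv_pos.2 hl) 0 * sElt := by
  apply SU11_ext <;> simp [entry_mul, mul_comm]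

theorem sElt_sq_mul_apply (g : SU11) (i j : Fin 2) :
    entry (sElt * sElt * g) i j = -entry g i j := by
  fin_cases i <;> simp [entry_mul]

/-- Bruhat decomposition: `SU(1,1)` is generated by `P` and `s`. -/
theorem SU11_induction {p : SU11 → Prop} (hmul : ∀ g h, p g → p h → p (g * h))
    (hP : ∀ l hl b, p (gP l hl b)) (hs : p sElt) (g : SU11) : p g := by
  obtain ⟨a, b, c, d, ha, hb, hc, hd, hdet⟩ := exists_entries g
  -- it is enough to treat `g` up to the sign `s² = -1`
  have key : ∀ g : SU11, ∀ a b c d : ℝ, entry g 0 0 = a → entry g 0 1 = Complex.I * b →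
      entry g 1 0 = Complex.I * c → entry g 1 1 = d → a * d + b * c = 1 →
      (0 < c ∨ c = 0 ∧ 0 < a) → p g := by
    intro g a b c d ha hb hc hd hdet h
    rcases h with h | ⟨rfl, h⟩
    · have hc' : (c : ℂ) ≠ 0 := by exact_mod_cast h.ne'
      have : g = gP 1 one_pos (-a / c) * sElt * gP c h (-d) := by
        apply SU11_ext <;> simp [entry_mul, *]
        · field_simp
          linear_combination a * Complex.I_sq
        · have : (b : ℂ) * c = 1 - a * d := by
            have : b * c = 1 - a * d := by linarith
            exact_mod_cast this
          field_simp
          linear_combination this - a * d * Complex.I_sq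
        · linear_combination (d : ℂ) * Complex.I_sq
      rw [this]
      exact hmul _ _ (hmul _ _ (hP _ _ _) hs) (hP _ _ _)
    · have ha' : (a : ℂ) ≠ 0 := by exact_mod_cast h.ne'
      have : g = gP a h b := by
        apply SU11_ext <;> simp [*]
        have : (a : ℂ) * d = 1 := by
          have : a * d = 1 := by linarith
          exact_mod_cast this
        field_simp
        linear_combination this
      rw [this]
      exact hP _ _ _
  have hneg : p (sElt * sElt * g) → p g := by
    intro h
    have : g = sElt * sElt * (sElt * sElt * g) := by
      apply SU11_ext <;> simp only [sElt_sq_mul_apply, neg_neg]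
    rw [this]
    exact hmul _ _ (hmul _ _ hs hs) h
  by_cases h : 0 < c ∨ c = 0 ∧ 0 < a
  · exact key g a b c d ha hb hc hd hdet h
  · apply hneg
    apply key _ (-a) (-b) (-c) (-d) <;> try simp only [sElt_sq_mul_apply, *]; push_cast; ring
    · linarith
    · push Not at h
      rcases lt_or_eq_of_le h.1 with h1 | h1
      · left; linarith
      · right
        refine ⟨by linarith, ?_⟩
        have h2 := h.2 h1
        have : a ≠ 0 := by rintro rfl; simp [h1] at hdet
        have := lt_of_le_of_ne h2 this
        linarith

/-- The centre of `SU(1,1)` consists of scalar matrices. -/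
theorem center_entries {h : SU11} (hh : h ∈ Subgroup.center SU11) :
    entry h 0 1 = 0 ∧ entry h 1 0 = 0 ∧ entry h 0 0 = entry h 1 1 := by
  rw [Subgroup.mem_center_iff] at hh
  have h1 := hh (gP 1 one_pos 1)
  have h2 := hh sElt
  have e1 := congrArg (fun g => entry g 0 0) h1
  have e2 := congrArg (fun g => entry g 0 0) h2
  have e3 := congrArg (fun g => entry g 0 1) h2
  simp [entry_mul] at e1 e2 e3
  rw [e1] at e2
  simp at e2
  exact ⟨e2, e1, by
    rw [mul_comm] at e3
    exact (mul_right_cancel₀ Complex.I_ne_zero e3).symm⟩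

theorem toPSU_sElt_sq : toPSU (sElt * sElt) = 1 := by
  rw [toPSU, QuotientGroup.mk'_apply, QuotientGroup.eq_one_iff, Subgroup.mem_center_iff]
  intro g
  apply SU11_ext <;> rw [sElt_sq_mul_apply, entry_mul] <;> simp [entry_mul]

/-- The elements `g(1,b)` and `s` satisfy the relation expressing that `s` sends the boundary
point `g(1,b)ξ₂` to `g(1,-1/b)ξ₂`. -/
theorem sElt_unip_sElt (b : ℝ) (hb : b ≠ 0) : ∃ l, ∃ hl : 0 < l, ∃ y,
    toPSU sElt * toPSU (gP 1 one_pos b) * toPSU sElt =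
      toPSU (gP 1 one_pos (-1 / b)) * toPSU sElt * toPSU (gP l hl y) := by
  have hb' : (b : ℂ) ≠ 0 := by exact_mod_cast hb
  rcases lt_or_gt_of_ne hb with h | h
  · refine ⟨-b, by linarith, 1, ?_⟩
    rw [← map_mul, ← map_mul, ← map_mul, ← map_mul]
    congr 1
    apply SU11_ext <;> simp [entry_mul, -neg_mul, neg_div] <;> field_simp
    · linear_combination Complex.I_sq
    · linear_combination Complex.I * Complex.I_sq
    · linear_combination Complex.I_sq
  · refine ⟨b, h, -1, ?_⟩
    rw [← map_mul, ← map_mul, ← map_mul, ← map_mul, ← one_mul (toPSU (_ * gP b h (-1))),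
      ← toPSU_sElt_sq, ← map_mul]
    congr 1
    apply SU11_ext <;> rw [sElt_sq_mul_apply] <;> simp [entry_mul, neg_div] <;> field_simp
    · linear_combination -Complex.I_sq
    · linear_combination Complex.I * Complex.I_sq
    · linear_combination Complex.I_sq

/-- `LDU`-type decomposition of the elements `g` with positive upper left entry: the lower
triangular factor is written as `s⁻¹g(1,x)s`. -/
theorem sElt_mul_eq_of_pos (g : SU11) {a b c : ℝ} (ha : entry g 0 0 = a)
    (hb : entry g 0 1 = Complex.I * b)
    (hc : entry g 1 0 = Complex.I * c) (h : 0 < a) :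
    sElt * g = gP 1 one_pos (c / a) * (sElt * (gP 1 one_pos (a * b) * gP a h 0)) := by
  have ha' : (a : ℂ) ≠ 0 := by exact_mod_cast h.ne'
  have hd := entry_det g
  rw [ha, hb, hc] at hd
  apply SU11_ext <;> simp [entry_mul, *] <;> field_simp
  linear_combination hd

/-! ### The form `Q` and its isometries -/

section Form

variable {M : Type*} [NormedAddCommGroup M] [InnerProductSpace ℂ M]

/-- The action of the linear automorphisms on the projective space. -/
noncomputable abbrev projPerm : (Model M ≃ₗ[ℂ] Model M) →* Equiv.Perm (ℙ ℂ (Model M)) :=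
  MulAction.toPermHom (Model M ≃ₗ[ℂ] Model M) (ℙ ℂ (Model M))

theorem Q_mk (a b : ℂ) (u : M) (a' b' : ℂ) (u' : M) :
    Q ((a, b, u) : Model M) (a', b', u') = a * star b' + b * star a' - inner ℂ u' u := rfl

theorem Q_add_left (v v' w : Model M) : Q (v + v') w = Q v w + Q v' w := by
  simp only [Q, Prod.fst_add, Prod.snd_add, inner_add_right]; ring

theorem Q_smul_left (a : ℂ) (v w : Model M) : Q (a • v) w = a * Q v w := by
  simp only [Q, Prod.smul_fst, Prod.smul_snd, inner_smul_right, smul_eq_mul]; ring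

theorem Q_star (v w : Model M) : star (Q v w) = Q w v := by
  simp only [Q, star_sub, star_add, star_mul', star_star]
  rw [← inner_conj_symm v.2.2 w.2.2]
  simp; ring

theorem Q_smul_right (a : ℂ) (v w : Model M) : Q v (a • w) = star a * Q v w := by
  rw [← Q_star, Q_smul_left, star_mul', Q_star]

theorem Q_sub_left (v v' w : Model M) : Q (v - v') w = Q v w - Q v' w := by
  rw [sub_eq_add_neg, Q_add_left, ← neg_one_smul ℂ v', Q_smul_left]; ring

theorem Q_eta1_right (v : Model M) : Q v (eta1 M) = v.2.1 := by simp [Q, eta1]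

theorem Q_eta2_right (v : Model M) : Q v (eta2 M) = v.1 := by simp [Q, eta2]

theorem Q_eta2_left (v : Model M) : Q (eta2 M) v = star v.1 := by simp [Q, eta2]

theorem Q_self (v : Model M) :
    Q v v = ((2 * (v.1 * star v.2.1).re - ‖v.2.2‖ ^ 2 : ℝ) : ℂ) := by
  have h : v.1 * star v.2.1 + v.2.1 * star v.1 = ((2 * (v.1 * star v.2.1).re : ℝ) : ℂ) := by
    apply Complex.ext <;> simp <;> ring
  rw [Q, h, inner_self_eq_norm_sq_to_K]
  push_cast
  rfl

theorem Q_self_eq_re (v : Model M) : Q v v = ((Q v v).re : ℂ) := by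
  rw [Q_self, Complex.ofReal_re]

theorem continuous_Q : Continuous fun p : Model M × Model M => Q p.1 p.2 := by
  unfold Q; fun_prop

theorem positive_ne_zero {v : Model M} (h : 0 < (Q v v).re) : v ≠ 0 := by
  rintro rfl; simp [Q] at h

theorem projPerm_mk (S : Model M ≃ₗ[ℂ] Model M) (v : Model M) (hv : v ≠ 0) :
    projPerm S (Projectivization.mk ℂ v hv) =
      Projectivization.mk ℂ (S v) (by simpa using hv) := rfl

theorem exists_UQ (x : PUQ M) : ∃ S ∈ UQ M, projPerm S = x.1 := x.2

/-- The isometry induced by an element of `U(Q)`. -/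
noncomputable def ofUQ (S : Model M ≃ₗ[ℂ] Model M) (hS : S ∈ UQ M) : PUQ M :=
  ⟨projPerm S, S, hS, rfl⟩

theorem UQ_apply {S : Model M ≃ₗ[ℂ] Model M} (hS : S ∈ UQ M) (v w : Model M) :
    Q (S v) (S w) = Q v w := hS v w

theorem UQ_symm {S : Model M ≃ₗ[ℂ] Model M} (hS : S ∈ UQ M) (v w : Model M) :
    Q (S v) w = Q v (S.symm w) := by
  rw [← UQ_apply hS v (S.symm w), LinearEquiv.apply_symm_apply]

theorem map_mk_eq_iff {x : PUQ M} {S : Model M ≃ₗ[ℂ] Model M} (hx : projPerm S = x.1)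
    {v w : Model M} (hv : v ≠ 0) (hw : w ≠ 0) :
    x.1 (Projectivization.mk ℂ v hv) = Projectivization.mk ℂ w hw ↔ ∃ a : ℂ, S v = a • w := by
  rw [← hx, projPerm_mk, Projectivization.mk_eq_mk_iff']
  exact ⟨fun ⟨a, h⟩ => ⟨a, h.symm⟩, fun ⟨a, h⟩ => ⟨a, h.symm⟩⟩

/-- A linear automorphism in `U(Q)` that acts trivially on the projective space is a scalar. -/
theorem eq_smul_of_projPerm_eq {S S' : Model M ≃ₗ[ℂ] Model M} (hS : S ∈ UQ M) (hS' : S' ∈ UQ M)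
    (h : projPerm S = projPerm S') : ∃ a : ℂ, ‖a‖ = 1 ∧ ∀ v, S v = a • S' v := by
  have hl (v : Model M) (hv : v ≠ 0) : ∃ a : ℂ, S v = a • S' v := by
    have := congrFun (congrArg DFunLike.coe h) (Projectivization.mk ℂ v hv)
    rw [projPerm_mk, projPerm_mk, Projectivization.mk_eq_mk_iff'] at this
    obtain ⟨a, ha⟩ := this
    exact ⟨a, ha.symm⟩
  -- `S'⁻¹S` preserves every line, hence is a scalar
  have hnl : ∀ v, ¬ LinearIndependent ℂ ![v, (S'.symm.toLinearMap ∘ₗ S.toLinearMap) v] := by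
    intro v hv
    have hv0 : v ≠ 0 := by simpa using hv.ne_zero 0
    obtain ⟨a, ha⟩ := hl v hv0
    have : (S'.symm.toLinearMap ∘ₗ S.toLinearMap) v = a • v := by simp [ha]
    rw [this, LinearIndependent.pair_iff] at hv
    simpa using hv a (-1) (by simp)
  obtain ⟨a, ha⟩ := LinearMap.exists_eq_smul_id_of_forall_notLinearIndependent hnl
  have hSa (v : Model M) : S v = a • S' v := by
    have := congrArg S' (LinearMap.congr_fun ha v)
    simpa using this
  refine ⟨a, ?_, hSa⟩
  have h1 := UQ_apply hS (eta1 M) (eta2 M)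
  rw [hSa, hSa, Q_smul_left, Q_smul_right, UQ_apply hS', ← mul_assoc, Q_eta2_right] at h1
  have h2 : a * star a = 1 := by simpa [eta1] using h1
  have h3 : ((‖a‖ ^ 2 : ℝ) : ℂ) = 1 := by
    rw [← h2, Complex.star_def, Complex.mul_conj, Complex.normSq_eq_norm_sq]
  have h4 : ‖a‖ ^ 2 = 1 := by exact_mod_cast h3
  exact (pow_eq_one_iff_of_nonneg (norm_nonneg a) two_ne_zero).1 h4

/-! ### Normalised linear representatives -/

/-- `S` is the linear representative of `x` in `U(Q)` that multiplies `η₁` by a positive number. -/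
def IsNormLift (x : PUQ M) (S : Model M ≃ₗ[ℂ] Model M) : Prop :=
  S ∈ UQ M ∧ projPerm S = x.1 ∧ ∃ r : ℝ, 0 < r ∧ S (eta1 M) = (r : ℂ) • eta1 M

theorem unit_smul_mem_UQ {S : Model M ≃ₗ[ℂ] Model M} (hS : S ∈ UQ M) {a : ℂ} (ha : ‖a‖ = 1) :
    ∃ S' ∈ UQ M, projPerm S' = projPerm S ∧ ∀ v, S' v = a • S v := by
  have ha0 : a ≠ 0 := by rintro rfl; simp at ha
  refine ⟨S.trans (LinearEquiv.smulOfNeZero ℂ _ a ha0), ?_, ?_, fun v => rfl⟩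
  · intro v w
    change Q (a • S v) (a • S w) = _
    rw [Q_smul_left, Q_smul_right, UQ_apply hS, ← mul_assoc, Complex.star_def, Complex.mul_conj,
      Complex.normSq_eq_norm_sq, ha]
    simp
  · ext p
    induction p using Projectivization.ind with
    | h v hv =>
      rw [projPerm_mk, projPerm_mk, Projectivization.mk_eq_mk_iff']
      exact ⟨a, rfl⟩

theorem IsNormLift.normLift_eq {x : PUQ M} {S : Model M ≃ₗ[ℂ] Model M} (h : IsNormLift x S)
    (v : Model M) : normLift x v = S v := by
  obtain ⟨hS, hx, r, hr, hr1⟩ := h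
  have hsl : someLift x ∈ UQ M ∧ projPerm (someLift x) = x.1 := x.2.choose_spec
  obtain ⟨a, ha, haS⟩ := eq_smul_of_projPerm_eq hsl.1 hS (hsl.2.trans hx.symm)
  have ha0 : a ≠ 0 := by rintro rfl; simp at ha
  have hr0 : (r : ℂ) ≠ 0 := by exact_mod_cast hr.ne'
  have hq : Q (someLift x (eta1 M)) (eta2 M) = a * r := by
    rw [haS, hr1, Q_eta2_right]; simp [eta1]
  have hn : star a * a = 1 := by
    rw [mul_comm, Complex.star_def, Complex.mul_conj, Complex.normSq_eq_norm_sq, ha]; simp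
  unfold normLift
  rw [hq, haS, smul_smul]
  convert one_smul ℂ (S v)
  rw [norm_mul, ha, Complex.norm_real, Real.norm_of_nonneg hr.le, star_mul']
  simp only [Complex.star_def, Complex.conj_ofReal, one_mul]
  rw [mul_div_assoc, div_self hr0, mul_one]
  exact hn

theorem IsNormLift.unique {x : PUQ M} {S S' : Model M ≃ₗ[ℂ] Model M} (h : IsNormLift x S)
    (h' : IsNormLift x S') : S = S' := by
  ext1 v
  rw [← h.normLift_eq, h'.normLift_eq]

theorem exists_isNormLift {x : PUQ M} (hx : x.1 (pt1 M) = pt1 M) : ∃ S, IsNormLift x S := by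
  obtain ⟨S, hS, hxS⟩ := exists_UQ x
  obtain ⟨a, ha⟩ := (map_mk_eq_iff hxS eta1_ne_zero eta1_ne_zero).1 hx
  have ha0 : a ≠ 0 := by
    rintro rfl
    rw [zero_smul, LinearEquiv.map_eq_zero_iff] at ha
    exact eta1_ne_zero ha
  obtain ⟨S', hS', h1, h2⟩ := unit_smul_mem_UQ hS (a := ‖a‖ / a) (by simp [ha0])
  refine ⟨S', hS', h1.trans hxS, ‖a‖, norm_pos_iff.2 ha0, ?_⟩
  rw [h2, ha, smul_smul, div_mul_cancel₀ _ ha0]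

theorem IsNormLift.mul {x y : PUQ M} {S S' : Model M ≃ₗ[ℂ] Model M} (h : IsNormLift x S)
    (h' : IsNormLift y S') : IsNormLift (x * y) (S * S') := by
  obtain ⟨hS, hx, r, hr, hr1⟩ := h
  obtain ⟨hS', hy, r', hr', hr1'⟩ := h'
  refine ⟨mul_mem hS hS', by rw [map_mul, hx, hy]; rfl, r * r', mul_pos hr hr', ?_⟩
  rw [LinearEquiv.mul_apply, hr1', map_smul, hr1, smul_smul]
  push_cast
  rw [mul_comm]

/-- An element of `U(Q)` that multiplies `η₁` by `r` preserves `η₁^⊥` and multiplies the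
`η₂`-component by `r⁻¹`. -/
theorem snd_of_map_eta1 {S : Model M ≃ₗ[ℂ] Model M} (hS : S ∈ UQ M) {r : ℝ}
    (h1 : S (eta1 M) = (r : ℂ) • eta1 M) (v : Model M) : r * (S v).2.1 = v.2.1 := by
  have h := UQ_apply hS v (eta1 M)
  rw [h1, Q_smul_right, Q_eta1_right, Q_eta1_right] at h
  simpa using h

/-! ### Points of the hyperbolic space and their distance -/

theorem hypDist_mk {v w : Model M} (hv : v ≠ 0) (hw : w ≠ 0) :
    hypDist (Projectivization.mk ℂ v hv) (Projectivization.mk ℂ w hw) =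
      Real.arcosh (‖Q v w‖ / (√(Q v v).re * √(Q w w).re)) := by
  obtain ⟨a, ha⟩ := Projectivization.exists_smul_eq_mk_rep ℂ v hv
  obtain ⟨b, hb⟩ := Projectivization.exists_smul_eq_mk_rep ℂ w hw
  have key (a : ℂ) (v : Model M) : √(Q (a • v) (a • v)).re = ‖a‖ * √(Q v v).re := by
    rw [Q_smul_left, Q_smul_right, ← mul_assoc, Complex.star_def, Complex.mul_conj,
      Complex.re_ofReal_mul, Complex.normSq_eq_norm_sq, Real.sqrt_mul (by positivity),
      Real.sqrt_sq (norm_nonneg a)]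
  have ha0 : ‖(a : ℂ)‖ ≠ 0 := by simp
  have hb0 : ‖(b : ℂ)‖ ≠ 0 := by simp
  unfold hypDist
  rw [← ha, ← hb]
  change Real.arcosh (‖Q ((a : ℂ) • v) ((b : ℂ) • w)‖ /
    (√(Q ((a : ℂ) • v) ((a : ℂ) • v)).re * √(Q ((b : ℂ) • w) ((b : ℂ) • w)).re)) = _
  rw [key, key, Q_smul_left, Q_smul_right, norm_mul, norm_mul, norm_star]
  congr 1
  field_simp

theorem mk_mem_hypSpace {v : Model M} (hv : v ≠ 0) :
    Projectivization.mk ℂ v hv ∈ hypSpace M ↔ 0 < (Q v v).re := by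
  obtain ⟨a, ha⟩ := Projectivization.exists_smul_eq_mk_rep ℂ v hv
  have ha0 : 0 < Complex.normSq (a : ℂ) := Complex.normSq_pos.2 a.ne_zero
  change 0 < (Q (Projectivization.mk ℂ v hv).rep (Projectivization.mk ℂ v hv).rep).re ↔ _
  rw [← ha]
  change 0 < (Q ((a : ℂ) • v) ((a : ℂ) • v)).re ↔ _
  rw [Q_smul_left, Q_smul_right, ← mul_assoc, Complex.star_def, Complex.mul_conj,
      Complex.re_ofReal_mul, mul_pos_iff_of_pos_left ha0]

theorem mk_mem_hypBoundary {v : Model M} (hv : v ≠ 0) :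
    Projectivization.mk ℂ v hv ∈ hypBoundary M ↔ Q v v = 0 := by
  obtain ⟨a, ha⟩ := Projectivization.exists_smul_eq_mk_rep ℂ v hv
  have ha0 : (a : ℂ) ≠ 0 := a.ne_zero
  change Q (Projectivization.mk ℂ v hv).rep (Projectivization.mk ℂ v hv).rep = 0 ↔ _
  rw [← ha]
  change Q ((a : ℂ) • v) ((a : ℂ) • v) = 0 ↔ _
  rw [Q_smul_left, Q_smul_right]
  simp [ha0]

/-- The distance between two images of a point is a matrix coefficient. -/
theorem hypDist_map_map {x y : PUQ M} {S S' : Model M ≃ₗ[ℂ] Model M} (hS : S ∈ UQ M)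
    (hS' : S' ∈ UQ M) (hx : projPerm S = x.1) (hy : projPerm S' = y.1) {v : Model M}
    (hv : 0 < (Q v v).re) :
    hypDist (x.1 (Projectivization.mk ℂ v (positive_ne_zero hv)))
      (y.1 (Projectivization.mk ℂ v (positive_ne_zero hv))) =
      Real.arcosh (‖Q (S v) (S' v)‖ / (Q v v).re) := by
  rw [← hx, ← hy, projPerm_mk, projPerm_mk, hypDist_mk, UQ_apply hS, UQ_apply hS',
    Real.mul_self_sqrt hv.le]

theorem rep_mk_mem_iff {v : Model M} (hv : v ≠ 0) (V : Submodule ℂ (Model M)) :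
    (Projectivization.mk ℂ v hv).rep ∈ V ↔ v ∈ V := by
  obtain ⟨a, ha⟩ := Projectivization.exists_smul_eq_mk_rep ℂ v hv
  rw [← ha]
  exact V.smul_mem_iff a.ne_zero

/-- Invariance of a subspace under a representation, in terms of linear representatives. -/
theorem rep_map_mem_iff {x : PUQ M} {S : Model M ≃ₗ[ℂ] Model M} (hx : projPerm S = x.1)
    {v : Model M} (hv : v ≠ 0) (V : Submodule ℂ (Model M)) :
    (x.1 (Projectivization.mk ℂ v hv)).rep ∈ V ↔ S v ∈ V := by
  rw [← hx, projPerm_mk, rep_mk_mem_iff]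

end Form

/-! ### The action of `SU(1,1)` on the isotropic vectors of `ℂ^{1,1}` -/

/-- The isotropic vectors of `ℂ^{1,1}` are the multiples of the vectors `(ix, y)` with `x, y` real,
and `SU(1,1)` acts on the latter: this is the action on the real coordinates `(x, y)`. -/
noncomputable def bdryAct (g : SU11) (p : ℝ × ℝ) : ℝ × ℝ :=
  ((entry g 0 0).re * p.1 + (entry g 0 1).im * p.2,
    (entry g 1 1).re * p.2 - (entry g 1 0).im * p.1)

theorem bdryAct_mul (g h : SU11) (p : ℝ × ℝ) : bdryAct (g * h) p = bdryAct g (bdryAct h p) := by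
  obtain ⟨a, b, c, d, h1, h2, h3, h4, -⟩ := exists_entries g
  obtain ⟨a', b', c', d', h1', h2', h3', h4', -⟩ := exists_entries h
  simp only [bdryAct, entry_mul, h1, h2, h3, h4, h1', h2', h3', h4']
  apply Prod.ext <;> simp <;> ring

theorem bdryAct_one (p : ℝ × ℝ) : bdryAct 1 p = p := by
  simp [bdryAct, entry_one]

theorem bdryAct_ne_zero (g : SU11) {p : ℝ × ℝ} (hp : p ≠ 0) : bdryAct g p ≠ 0 := by
  intro h
  apply hp
  rw [← bdryAct_one p, ← inv_mul_cancel g, bdryAct_mul, h]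
  simp [bdryAct]

theorem bdryAct_diag (l : ℝ) (hl : 0 < l) (p : ℝ × ℝ) :
    bdryAct (gP l hl 0) p = (l * p.1, l⁻¹ * p.2) := by
  have : ((l : ℂ)⁻¹).re = l⁻¹ := by rw [← Complex.ofReal_inv, Complex.ofReal_re]
  simp [bdryAct, -Complex.inv_re, this]

theorem bdryAct_unip (b : ℝ) (p : ℝ × ℝ) :
    bdryAct (gP 1 one_pos b) p = (p.1 + b * p.2, p.2) := by
  simp [bdryAct]

theorem bdryAct_sElt (p : ℝ × ℝ) : bdryAct sElt p = (p.2, -p.1) := by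
  simp [bdryAct]

/-! ### Equivariant boundary maps -/

section Boundary

variable {M : Type*} [NormedAddCommGroup M] [InnerProductSpace ℂ M]

/-- The vector `K(b)η₁ + η₂ + c(b)`, the image of `η₂` under the unipotent element of
parameter `b`. -/
def horoVec (K : ℝ → ℂ) (c : ℝ → M) (b : ℝ) : Model M := (K b, 1, c b)

/-- The vector attached to the isotropic vector `(ix, y)` of `ℂ^{1,1}`; it depends on its line
only, and is `η₁` for `y = 0`. -/
noncomputable def bdryVec (K : ℝ → ℂ) (c : ℝ → M) (p : ℝ × ℝ) : Model M :=
  if p.2 = 0 then eta1 M else horoVec K c (p.1 / p.2)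

omit [InnerProductSpace ℂ M] in
theorem horoVec_ne_zero (K : ℝ → ℂ) (c : ℝ → M) (b : ℝ) : horoVec K c b ≠ 0 := by
  simp [horoVec, Prod.ext_iff]

theorem bdryVec_ne_zero (K : ℝ → ℂ) (c : ℝ → M) (p : ℝ × ℝ) : bdryVec K c p ≠ 0 := by
  unfold bdryVec
  split_ifs
  exacts [eta1_ne_zero, horoVec_ne_zero _ _ _]

/-- The isometry `x` acts like `g` on the boundary points of parameter in `P¹(ℝ)`. -/
def IsEquivariant (K : ℝ → ℂ) (c : ℝ → M) (g : SU11) (x : PUQ M) : Prop :=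
  ∀ p : ℝ × ℝ, p ≠ 0 → x.1 (Projectivization.mk ℂ (bdryVec K c p) (bdryVec_ne_zero K c p)) =
    Projectivization.mk ℂ (bdryVec K c (bdryAct g p)) (bdryVec_ne_zero K c _)

variable {K : ℝ → ℂ} {c : ℝ → M}

omit [InnerProductSpace ℂ M] in
theorem bdryVec_inf {p : ℝ × ℝ} (h : p.2 = 0) : bdryVec K c p = eta1 M := if_pos h

omit [InnerProductSpace ℂ M] in
theorem bdryVec_fin {p : ℝ × ℝ} (h : p.2 ≠ 0) : bdryVec K c p = horoVec K c (p.1 / p.2) :=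
  if_neg h

theorem bdryVec_one_right (b : ℝ) : bdryVec K c (b, 1) = horoVec K c b := by
  rw [bdryVec_fin (by simp)]; simp

theorem IsEquivariant.mul {g h : SU11} {x y : PUQ M} (hg : IsEquivariant K c g x)
    (hh : IsEquivariant K c h y) : IsEquivariant K c (g * h) (x * y) := by
  intro p hp
  rw [Subgroup.coe_mul, Equiv.Perm.mul_apply, hh p hp, hg _ (bdryAct_ne_zero h hp)]
  simp only [bdryAct_mul]

theorem IsEquivariant.exists_smul {g : SU11} {x : PUQ M} (h : IsEquivariant K c g x)
    {S : Model M ≃ₗ[ℂ] Model M} (hx : projPerm S = x.1) {p : ℝ × ℝ} (hp : p ≠ 0) :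
    ∃ a : ℂ, S (bdryVec K c p) = a • bdryVec K c (bdryAct g p) :=
  (map_mk_eq_iff hx _ _).1 (h p hp)

theorem isEquivariant_of_lift {g : SU11} {x : PUQ M} {S : Model M ≃ₗ[ℂ] Model M}
    (hx : projPerm S = x.1)
    (h : ∀ p : ℝ × ℝ, p ≠ 0 → ∃ a : ℂ, S (bdryVec K c p) = a • bdryVec K c (bdryAct g p)) :
    IsEquivariant K c g x :=
  fun p hp => (map_mk_eq_iff hx _ _).2 (h p hp)

theorem isEquivariant_diag {l : ℝ} {hl : 0 < l} {x : PUQ M} {S : Model M ≃ₗ[ℂ] Model M}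
    (hx : projPerm S = x.1) (h1 : ∃ a : ℂ, S (eta1 M) = a • eta1 M)
    (h2 : ∀ b, ∃ a : ℂ, S (horoVec K c b) = a • horoVec K c (l ^ 2 * b)) :
    IsEquivariant K c (gP l hl 0) x := by
  refine isEquivariant_of_lift hx fun p _ => ?_
  rw [bdryAct_diag]
  by_cases hp2 : p.2 = 0
  · rw [bdryVec_inf hp2, bdryVec_inf (by simp [hp2])]
    exact h1
  · rw [bdryVec_fin hp2, bdryVec_fin (by simp [hp2, hl.ne'])]
    convert h2 (p.1 / p.2) using 4
    simp only
    field_simp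

theorem isEquivariant_unip {b : ℝ} {x : PUQ M} {S : Model M ≃ₗ[ℂ] Model M}
    (hx : projPerm S = x.1) (h1 : ∃ a : ℂ, S (eta1 M) = a • eta1 M)
    (h2 : ∀ b', ∃ a : ℂ, S (horoVec K c b') = a • horoVec K c (b' + b)) :
    IsEquivariant K c (gP 1 one_pos b) x := by
  refine isEquivariant_of_lift hx fun p _ => ?_
  rw [bdryAct_unip]
  by_cases hp2 : p.2 = 0
  · rw [bdryVec_inf hp2, bdryVec_inf (by simp [hp2])]
    exact h1
  · rw [bdryVec_fin hp2, bdryVec_fin (by simp [hp2])]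
    convert h2 (p.1 / p.2) using 4
    simp only
    field_simp

theorem isEquivariant_sElt {x : PUQ M} {S : Model M ≃ₗ[ℂ] Model M}
    (hx : projPerm S = x.1) (h1 : ∃ a : ℂ, S (eta1 M) = a • horoVec K c 0)
    (h2 : ∃ a : ℂ, S (horoVec K c 0) = a • eta1 M)
    (h3 : ∀ b, b ≠ 0 → ∃ a : ℂ, S (horoVec K c b) = a • horoVec K c (-1 / b)) :
    IsEquivariant K c sElt x := by
  refine isEquivariant_of_lift hx fun p hp => ?_
  rw [bdryAct_sElt]
  by_cases hp2 : p.2 = 0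
  · have hp1 : p.1 ≠ 0 := fun h => hp (Prod.ext h hp2)
    rw [bdryVec_inf hp2, bdryVec_fin (by simpa using hp1)]
    simpa [hp2] using h1
  · rw [bdryVec_fin hp2]
    by_cases hp1 : p.1 = 0
    · rw [bdryVec_inf (by simp [hp1])]
      simpa [hp1] using h2
    · rw [bdryVec_fin (by simpa using hp1)]
      convert h3 (p.1 / p.2) (div_ne_zero hp1 hp2) using 4
      simp only
      field_simp

/-- The elements of the centre of `SU(1,1)` act trivially on the boundary. -/
theorem bdryVec_of_center {h : SU11} (hh : h ∈ Subgroup.center SU11) (p : ℝ × ℝ) :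
    bdryVec K c (bdryAct h p) = bdryVec K c p := by
  obtain ⟨h01, h10, h00⟩ := center_entries hh
  obtain ⟨a, b, c', d, e1, e2, e3, e4, hd⟩ := exists_entries h
  have had : a = d := by rw [e1, e4] at h00; exact_mod_cast h00
  have hb : b = 0 := by rw [h01] at e2; simpa using e2.symm
  have ha : a ≠ 0 := by rintro rfl; simp [hb] at hd
  have : bdryAct h p = (a * p.1, a * p.2) := by
    simp [bdryAct, h01, h10, e1, e4, had]
  rw [this]
  by_cases hp2 : p.2 = 0
  · rw [bdryVec_inf hp2, bdryVec_inf (by simp [hp2])]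
  · rw [bdryVec_fin hp2, bdryVec_fin (by simp [hp2, ha])]
    congr 1
    simp only
    field_simp

end Boundary

/-! ### The kernel of a horospherical cocycle -/

/-- The function `|x|^t κ` for `x ≥ 0`, and `|x|^t κ̄` for `x < 0`. -/
noncomputable def kerK (t : ℝ) (κ : ℂ) (x : ℝ) : ℂ :=
  ((|x| ^ t : ℝ) : ℂ) * if 0 ≤ x then κ else star κ

section kerK

variable {t : ℝ} {κ : ℂ}

theorem kerK_zero (ht : t ≠ 0) : kerK t κ 0 = 0 := by
  simp [kerK, Real.zero_rpow ht]

theorem kerK_one : kerK t κ 1 = κ := by simp [kerK]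

theorem kerK_of_pos {x : ℝ} (hx : 0 < x) : kerK t κ x = ((|x| ^ t : ℝ) : ℂ) * κ := by
  rw [kerK, if_pos hx.le]

theorem kerK_of_neg {x : ℝ} (hx : x < 0) : kerK t κ x = ((|x| ^ t : ℝ) : ℂ) * star κ := by
  rw [kerK, if_neg hx.not_ge]

theorem kerK_neg (ht : t ≠ 0) (x : ℝ) : kerK t κ (-x) = star (kerK t κ x) := by
  rcases lt_trichotomy x 0 with h | rfl | h
  · rw [kerK_of_neg h, kerK_of_pos (by linarith)]; simp
  · simp [kerK_zero ht]
  · rw [kerK_of_pos h, kerK_of_neg (by linarith)]; simp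

theorem kerK_re (x : ℝ) : (kerK t κ x).re = |x| ^ t * κ.re := by
  unfold kerK
  split_ifs <;> simp

theorem kerK_add (κ' : ℂ) (x : ℝ) : kerK t (κ + κ') x = kerK t κ x + kerK t κ' x := by
  unfold kerK
  split_ifs
  · ring
  · rw [star_add]; ring

theorem norm_kerK (x : ℝ) : ‖kerK t κ x‖ = |x| ^ t * ‖κ‖ := by
  have : (0 : ℝ) ≤ |x| ^ t := by positivity
  unfold kerK
  split_ifs <;> simp [abs_of_nonneg this]

theorem kerK_ne_zero (hκ : κ ≠ 0) {x : ℝ} (hx : x ≠ 0) : kerK t κ x ≠ 0 := by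
  rw [← norm_ne_zero_iff, norm_kerK]
  have : 0 < |x| ^ t := Real.rpow_pos_of_pos (abs_pos.2 hx) t
  exact mul_ne_zero this.ne' (norm_ne_zero_iff.2 hκ)

theorem kerK_mul_pos {m : ℝ} (hm : 0 < m) (x : ℝ) :
    kerK t κ (m * x) = ((m ^ t : ℝ) : ℂ) * kerK t κ x := by
  have h : (0 ≤ m * x) ↔ 0 ≤ x := mul_nonneg_iff_of_pos_left hm
  unfold kerK
  rw [abs_mul, abs_of_pos hm, Real.mul_rpow hm.le (abs_nonneg x)]
  simp only [h]
  push_cast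
  ring

theorem kerK_sq_mul {l : ℝ} (hl : 0 < l) (x : ℝ) :
    kerK t κ (l ^ 2 * x) = ((l ^ t : ℝ) : ℂ) ^ 2 * kerK t κ x := by
  rw [kerK_mul_pos (by positivity), ← Complex.ofReal_pow, ← Real.rpow_natCast, ← Real.rpow_natCast,
    ← Real.rpow_mul hl.le, ← Real.rpow_mul hl.le, mul_comm t]

theorem mul_star_eq_norm_sq (z : ℂ) : z * star z = ((‖z‖ ^ 2 : ℝ) : ℂ) := by
  rw [Complex.star_def, Complex.mul_conj, Complex.normSq_eq_norm_sq]

/-- The functional equation of `K` that makes `c(b) ↦ K(b)c(-1/b)` isometric up to a factor. -/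
theorem kerK_mul_mul {a b : ℝ} (ht : t ≠ 0) (ha : a ≠ 0) (hb : b ≠ 0) :
    kerK t κ a * kerK t κ (-b) * kerK t κ (1 / b - 1 / a) =
      ((‖κ‖ ^ 2 : ℝ) : ℂ) * kerK t κ (a - b) := by
  rcases eq_or_ne a b with rfl | hab
  · simp [kerK_zero ht]
  have hab0 : a - b ≠ 0 := sub_ne_zero.2 hab
  have e : 1 / b - 1 / a = (a - b) / (a * b) := by field_simp
  have habs : |a| ^ t * |-b| ^ t * |1 / b - 1 / a| ^ t = |a - b| ^ t := by
    rw [← Real.mul_rpow (abs_nonneg _) (abs_nonneg _), ← Real.mul_rpow (by positivity)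
      (abs_nonneg _), e, abs_div, abs_mul, abs_neg]
    congr 1
    have := abs_pos.2 ha
    have := abs_pos.2 hb
    field_simp
  rw [← mul_star_eq_norm_sq, e]
  rw [e] at habs
  have hpos {x : ℝ} (h : 0 < x) := kerK_of_pos (t := t) (κ := κ) h
  have hneg {x : ℝ} (h : x < 0) := kerK_of_neg (t := t) (κ := κ) h
  -- the exponents of `κ` and `κ̄` agree for each choice of the signs of `a`, `b`, `a - b`
  rcases lt_or_gt_of_ne ha with ha | ha <;> rcases lt_or_gt_of_ne hb with hb | hb
  · have hm := mul_pos_of_neg_of_neg ha hb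
    rcases lt_or_gt_of_ne hab0 with h | h
    · rw [hneg ha, hpos (by linarith : 0 < -b), hneg (div_neg_of_neg_of_pos h hm), hneg h, ← habs]
      push_cast; ring
    · rw [hneg ha, hpos (by linarith : 0 < -b), hpos (div_pos h hm), hpos h, ← habs]
      push_cast; ring
  · have hm := mul_neg_of_neg_of_pos ha hb
    have h : a - b < 0 := by linarith
    rw [hneg ha, hneg (by linarith : -b < 0), hpos (div_pos_of_neg_of_neg h hm), hneg h, ← habs]
    push_cast; ring
  · have hm := mul_neg_of_pos_of_neg ha hb
    have h : 0 < a - b := by linarith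
    rw [hpos ha, hpos (by linarith : 0 < -b), hneg (div_neg_of_pos_of_neg h hm), hpos h, ← habs]
    push_cast; ring
  · have hm := mul_pos ha hb
    rcases lt_or_gt_of_ne hab0 with h | h
    · rw [hpos ha, hneg (by linarith : -b < 0), hneg (div_neg_of_neg_of_pos h hm), hneg h, ← habs]
      push_cast; ring
    · rw [hpos ha, hneg (by linarith : -b < 0), hpos (div_pos h hm), hpos h, ← habs]
      push_cast; ring

theorem kerK_neg_one_div {b : ℝ} (hb : b ≠ 0) :
    kerK t κ b * kerK t κ (-1 / b) = ((‖κ‖ ^ 2 : ℝ) : ℂ) := by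
  have hb' := abs_pos.2 hb
  have habs : |b| ^ t * |-1 / b| ^ t = 1 := by
    rw [← Real.mul_rpow (abs_nonneg _) (abs_nonneg _), abs_div]
    simp [hb'.ne']
  rw [← mul_star_eq_norm_sq]
  rcases lt_or_gt_of_ne hb with h | h
  · rw [kerK_of_neg h, kerK_of_pos (div_pos_of_neg_of_neg (by norm_num) h)]
    have : (((|b| ^ t * |-1 / b| ^ t : ℝ)) : ℂ) = 1 := by rw [habs]; simp
    rw [Complex.ofReal_mul] at this
    linear_combination (κ * star κ) * this
  · rw [kerK_of_pos h, kerK_of_neg (div_neg_of_neg_of_pos (by norm_num) h)]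
    have : (((|b| ^ t * |-1 / b| ^ t : ℝ)) : ℂ) = 1 := by rw [habs]; simp
    rw [Complex.ofReal_mul] at this
    linear_combination (κ * star κ) * this

end kerK

/-! ### Isometries with prescribed values on a total family -/

section Gram

variable {M : Type*} [NormedAddCommGroup M] [InnerProductSpace ℂ M]

theorem inner_linearCombination {ι : Type*} (c : ι → M) (x y : ι →₀ ℂ) :
    inner ℂ (Finsupp.linearCombination ℂ c x) (Finsupp.linearCombination ℂ c y) =
      x.sum fun i a => y.sum fun j b => star a * b * inner ℂ (c i) (c j) := by
  rw [Finsupp.linearCombination_apply, Finsupp.linearCombination_apply, Finsupp.sum_inner]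
  refine Finsupp.sum_congr fun i _ => ?_
  rw [Finsupp.inner_sum]
  refine Finsupp.sum_congr fun j _ => ?_
  simp [inner_smul_left, inner_smul_right]
  ring

/-- Two total families with the same Gram matrix correspond under a unitary operator. -/
theorem exists_isometry_of_gram [CompleteSpace M] {ι : Type*} {c c' : ι → M}
    (hc : (Submodule.span ℂ (Set.range c)).topologicalClosure = ⊤)
    (hc' : (Submodule.span ℂ (Set.range c')).topologicalClosure = ⊤)
    (h : ∀ i j, inner ℂ (c' i) (c' j) = inner ℂ (c i) (c j)) :
    ∃ U : M ≃ₗᵢ[ℂ] M, ∀ i, U (c i) = c' i := by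
  have hdense {c : ι → M} (hc : (Submodule.span ℂ (Set.range c)).topologicalClosure = ⊤) :
      DenseRange (Finsupp.linearCombination ℂ c) := by
    rw [DenseRange, ← LinearMap.coe_range, Finsupp.range_linearCombination]
    exact Submodule.dense_iff_topologicalClosure_eq_top.2 hc
  have hnorm (x : ι →₀ ℂ) : ‖Finsupp.linearCombination ℂ c' (LinearEquiv.refl ℂ (ι →₀ ℂ) x)‖ =
      ‖Finsupp.linearCombination ℂ c x‖ := by
    rw [@norm_eq_sqrt_re_inner ℂ, @norm_eq_sqrt_re_inner ℂ]
    rw [LinearEquiv.refl_apply, inner_linearCombination, inner_linearCombination]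
    simp only [h]
  refine ⟨(LinearEquiv.refl ℂ (ι →₀ ℂ)).extendOfIsometry _ _ (hdense hc) (hdense hc') hnorm, ?_⟩
  intro i
  have := LinearEquiv.extendOfIsometry_eq (LinearEquiv.refl ℂ (ι →₀ ℂ)) _ _ (hdense hc) (hdense hc')
    hnorm (Finsupp.single i 1)
  simpa using this

theorem eq_of_eqOn_total {N : Type*} [TopologicalSpace N] [T2Space N] [AddCommGroup N] [Module ℂ N]
    {ι : Type*} {c : ι → M}
    (hc : (Submodule.span ℂ (Set.range c)).topologicalClosure = ⊤) {f g : M →L[ℂ] N}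
    (h : ∀ i, f (c i) = g (c i)) : f = g :=
  ContinuousLinearMap.ext_on (Submodule.dense_iff_topologicalClosure_eq_top.2 hc)
    (by rintro _ ⟨i, rfl⟩; exact h i)

end Gram

/-! ### Block isometries -/

section Blocks

variable {M : Type*} [NormedAddCommGroup M] [InnerProductSpace ℂ M]

/-- The automorphism with matrix `diag(χ, χ⁻¹, π)`. -/
noncomputable def diagEquiv (χ : ℝ) (hχ : χ ≠ 0) (π : M ≃ₗᵢ[ℂ] M) : Model M ≃ₗ[ℂ] Model M where
  toFun := diagBlock χ π
  map_add' v w := by simp [diagBlock, mul_add]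
  map_smul' a v := by simp [diagBlock, mul_left_comm]
  invFun := diagBlock χ⁻¹ π.symm
  left_inv v := by simp [diagBlock, hχ]
  right_inv v := by simp [diagBlock, hχ]

theorem diagEquiv_apply (χ : ℝ) (hχ : χ ≠ 0) (π : M ≃ₗᵢ[ℂ] M) (v : Model M) :
    diagEquiv χ hχ π v = diagBlock χ π v := rfl

theorem diagEquiv_mem (χ : ℝ) (hχ : χ ≠ 0) (π : M ≃ₗᵢ[ℂ] M) : diagEquiv χ hχ π ∈ UQ M := by
  intro v w
  have : (χ : ℂ) ≠ 0 := by exact_mod_cast hχ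
  simp only [diagEquiv_apply, diagBlock, Q, star_mul', LinearIsometryEquiv.inner_map_map]
  simp only [Complex.star_def, map_inv₀, Complex.conj_ofReal]
  field_simp

/-- The automorphism with rows `(1, k, ⟨π ·, c⟩)`, `(0, 1, 0)`, `(0, c, π)`. -/
noncomputable def unipEquiv (k : ℂ) (c : M) (π : M ≃ₗᵢ[ℂ] M) : Model M ≃ₗ[ℂ] Model M where
  toFun := unipBlock k c π
  map_add' v w := by
    simp only [unipBlock, Prod.fst_add, Prod.snd_add, map_add, inner_add_right, add_smul,
      Prod.mk_add_mk, Prod.mk.injEq, true_and]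
    exact ⟨by ring, by abel⟩
  map_smul' a v := by
    simp only [unipBlock, Prod.smul_fst, Prod.smul_snd, map_smul, inner_smul_right, smul_eq_mul,
      RingHom.id_apply, Prod.smul_mk, smul_add, smul_smul, Prod.mk.injEq, and_true]
    ring
  invFun w := (w.1 - k * w.2.1 - inner ℂ c (w.2.2 - w.2.1 • c), w.2.1,
    π.symm (w.2.2 - w.2.1 • c))
  left_inv v := by
    simp [unipBlock]
    exact Prod.ext (by dsimp only; ring) rfl
  right_inv v := by
    simp [unipBlock]
    exact Prod.ext (by dsimp only; ring) rfl

theorem unipEquiv_apply (k : ℂ) (c : M) (π : M ≃ₗᵢ[ℂ] M) (v : Model M) :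
    unipEquiv k c π v = unipBlock k c π v := rfl

theorem unipEquiv_mem {k : ℂ} {c : M} (hk : k + star k = ((‖c‖ ^ 2 : ℝ) : ℂ)) (π : M ≃ₗᵢ[ℂ] M) :
    unipEquiv k c π ∈ UQ M := by
  intro v w
  simp only [unipEquiv_apply, unipBlock, Q, star_mul', star_add, inner_add_left, inner_add_right,
    inner_smul_left, inner_smul_right, LinearIsometryEquiv.inner_map_map,
    inner_self_eq_norm_sq_to_K]
  simp only [Complex.star_def, inner_conj_symm] at hk ⊢
  push_cast at hk
  simp only [Complex.coe_algebraMap]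
  linear_combination (v.2.1 * (starRingEnd ℂ) w.2.1) * hk

/-- The automorphism exchanging the lines of `η₁` and `η₂`. -/
noncomputable def swapEquiv (ν : ℝ) (hν : ν ≠ 0) (A : M ≃ₗᵢ[ℂ] M) : Model M ≃ₗ[ℂ] Model M where
  toFun := swapBlock ν A
  map_add' v w := by simp [swapBlock, mul_add]
  map_smul' a v := by simp [swapBlock, mul_left_comm]
  invFun := swapBlock ν A.symm
  left_inv v := by simp [swapBlock, hν]
  right_inv v := by simp [swapBlock, hν]

theorem swapEquiv_apply (ν : ℝ) (hν : ν ≠ 0) (A : M ≃ₗᵢ[ℂ] M) (v : Model M) :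
    swapEquiv ν hν A v = swapBlock ν A v := rfl

theorem swapEquiv_mem (ν : ℝ) (hν : ν ≠ 0) (A : M ≃ₗᵢ[ℂ] M) : swapEquiv ν hν A ∈ UQ M := by
  intro v w
  have : (ν : ℂ) ≠ 0 := by exact_mod_cast hν
  simp only [swapEquiv_apply, swapBlock, Q, star_mul', LinearIsometryEquiv.inner_map_map]
  simp only [Complex.star_def, map_inv₀, Complex.conj_ofReal]
  field_simp
  ring

end Blocks

/-! ### Horospherical cocycles -/

section Cocycle

variable {M : Type*} [NormedAddCommGroup M] [InnerProductSpace ℂ M]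

/-- A total family `c : ℝ → M` whose Gram matrix is given by the kernel
`K(x) = |x|^t κ` (`x ≥ 0`), `|x|^t κ̄` (`x < 0`), with `t > 0` and `Re κ > 0`. -/
structure IsHoroCocycle (t : ℝ) (κ : ℂ) (c : ℝ → M) : Prop where
  t_pos : 0 < t
  re_pos : 0 < κ.re
  gram : ∀ a b, inner ℂ (c b) (c a) = kerK t κ a + kerK t κ (-b) - kerK t κ (a - b)
  total : (Submodule.span ℂ (Set.range c)).topologicalClosure = ⊤

namespace IsHoroCocycle

variable {t : ℝ} {κ : ℂ} {c : ℝ → M} (h : IsHoroCocycle t κ c)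
include h

theorem ne_zero : κ ≠ 0 := by
  rintro rfl; simpa using h.re_pos

theorem kerK_zero : kerK t κ 0 = 0 := Horo.kerK_zero h.t_pos.ne'

theorem add_star (b : ℝ) : kerK t κ b + star (kerK t κ b) = ((‖c b‖ ^ 2 : ℝ) : ℂ) := by
  have := h.gram b b
  rw [sub_self, h.kerK_zero, kerK_neg h.t_pos.ne', inner_self_eq_norm_sq_to_K, sub_zero] at this
  rw [← this]
  simp

theorem norm_sq_sub (a b : ℝ) : ‖c a - c b‖ ^ 2 = 2 * (|a - b| ^ t * κ.re) := by
  have e : inner ℂ (c a - c b) (c a - c b) =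
      kerK t κ (a - b) + star (kerK t κ (a - b)) := by
    rw [inner_sub_left, inner_sub_right, inner_sub_right, h.gram, h.gram, h.gram, h.gram,
      ← kerK_neg h.t_pos.ne', neg_sub, sub_self, sub_self, h.kerK_zero]
    ring
  rw [inner_self_eq_norm_sq_to_K] at e
  have := congrArg Complex.re e
  rw [Complex.add_re, Complex.star_def, Complex.conj_re, kerK_re] at this
  rw [← two_mul] at this
  rw [← this]
  simp [← Complex.ofReal_pow]

theorem continuous : Continuous c := by
  rw [continuous_iff_continuousAt]
  intro a
  rw [ContinuousAt, tendsto_iff_norm_sub_tendsto_zero]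
  have h2 : Filter.Tendsto (fun b => √(2 * (|b - a| ^ t * κ.re))) (𝓝 a) (𝓝 0) := by
    have : Continuous fun b => √(2 * (|b - a| ^ t * κ.re)) := by
      have := (Real.continuous_rpow_const h.t_pos.le).comp (continuous_abs.comp
        (continuous_sub_right a))
      exact Real.continuous_sqrt.comp (continuous_const.mul (this.mul continuous_const))
    convert! this.tendsto a using 2
    simp [Real.zero_rpow h.t_pos.ne']
  refine h2.congr fun b => ?_
  rw [← h.norm_sq_sub, Real.sqrt_sq (norm_nonneg _)]

theorem apply_zero : c 0 = 0 := by
  have := h.add_star 0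
  rw [h.kerK_zero] at this
  have h0 : ‖c 0‖ ^ 2 = 0 := by simpa using this.symm
  simpa using h0

theorem Q_horoVec (a b : ℝ) :
    Q (horoVec (kerK t κ) c a) (horoVec (kerK t κ) c b) = kerK t κ (a - b) := by
  rw [horoVec, horoVec, Q_mk, h.gram, kerK_neg h.t_pos.ne']
  simp

theorem horoVec_zero : horoVec (kerK t κ) c 0 = eta2 M := by
  rw [horoVec, h.kerK_zero, h.apply_zero]; rfl

/-- A vector that is orthogonal to all the boundary vectors vanishes, because `c` is total. -/
theorem eq_zero_of_orthogonal {v : Model M}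
    (hv : ∀ p : ℝ × ℝ, p ≠ 0 → Q v (bdryVec (kerK t κ) c p) = 0) : v = 0 := by
  have h1 := hv (1, 0) (by simp)
  have hb (b : ℝ) : Q v (horoVec (kerK t κ) c b) = 0 := by
    rw [← bdryVec_one_right]; exact hv (b, 1) (by simp)
  have h2 := hb 0
  rw [bdryVec_inf rfl, Q_eta1_right] at h1
  rw [h.horoVec_zero, Q_eta2_right] at h2
  have h3 : innerSL ℂ v.2.2 = 0 := by
    apply eq_of_eqOn_total h.total
    intro b
    have := hb b
    simp only [Q, horoVec, h1, h2] at this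
    rw [innerSL_apply_apply, ← inner_conj_symm, show inner ℂ (c b) v.2.2 = 0 by simpa using this]
    simp
  have h4 : v.2.2 = 0 := by
    have := congrArg (fun f : M →L[ℂ] ℂ => f v.2.2) h3
    simpa using this
  exact Prod.ext h2 (Prod.ext h1 h4)

/-- An isometry is determined by its action on the boundary points `[η₁]` and
`[K(b)η₁ + η₂ + c(b)]`. -/
theorem equivariant_unique {g : SU11} {x y : PUQ M} (hx : IsEquivariant (kerK t κ) c g x)
    (hy : IsEquivariant (kerK t κ) c g y) : x = y := by
  obtain ⟨S, hS, hxS⟩ := exists_UQ x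
  obtain ⟨S', hS', hyS⟩ := exists_UQ y
  have hm (p : ℝ × ℝ) (hp : p ≠ 0) : ∃ m : ℂ, S (bdryVec (kerK t κ) c p) =
      m • S' (bdryVec (kerK t κ) c p) := by
    obtain ⟨a, ha⟩ := hx.exists_smul hxS hp
    obtain ⟨a', ha'⟩ := hy.exists_smul hyS hp
    have ha0 : a' ≠ 0 := by
      rintro rfl
      rw [zero_smul, LinearEquiv.map_eq_zero_iff] at ha'
      exact bdryVec_ne_zero _ _ _ ha'
    exact ⟨a / a', by rw [ha, ha', smul_smul, div_mul_cancel₀ _ ha0]⟩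
  choose! m hm using hm
  have hmul (p q : ℝ × ℝ) (hp : p ≠ 0) (hq : q ≠ 0)
      (hne : Q (bdryVec (kerK t κ) c p) (bdryVec (kerK t κ) c q) ≠ 0) :
      m p * star (m q) = 1 := by
    have := UQ_apply hS (bdryVec (kerK t κ) c p) (bdryVec (kerK t κ) c q)
    rw [hm p hp, hm q hq, Q_smul_left, Q_smul_right, UQ_apply hS', ← mul_assoc] at this
    exact mul_right_cancel₀ hne (this.trans (one_mul _).symm)
  -- `m p * star (m q) = 1` for all pairs of distinct points forces `m` to be a constant of
  -- modulus one
  have hinf (b : ℝ) : m (b, 1) * star (m (1, 0)) = 1 := by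
    apply hmul _ _ (by simp) (by simp)
    rw [bdryVec_one_right, bdryVec_inf rfl, Q_eta1_right]
    simp [horoVec]
  have h01 : m (1, 1) * star (m (0, 1)) = 1 := by
    apply hmul _ _ (by simp) (by simp)
    rw [bdryVec_one_right, bdryVec_one_right, h.Q_horoVec]
    exact kerK_ne_zero h.ne_zero (by norm_num)
  have hstar : star (m (1, 0)) ≠ 0 := fun e => by simpa [e] using hinf 0
  have hfin (b : ℝ) : m (b, 1) = m (0, 1) :=
    mul_right_cancel₀ hstar ((hinf b).trans (hinf 0).symm)
  have hunit : m (0, 1) * star (m (0, 1)) = 1 := by rwa [hfin 1] at h01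
  have hinf' : m (1, 0) = m (0, 1) := by
    have h0 : m (0, 1) ≠ 0 := fun e => by simp [e] at hunit
    exact star_injective (mul_left_cancel₀ h0 ((hinf 0).trans hunit.symm))
  have hall (b : ℝ) : S (horoVec (kerK t κ) c b) = m (0, 1) • S' (horoVec (kerK t κ) c b) := by
    rw [← hfin b, ← bdryVec_one_right, hm _ (by simp)]
  have hbdry (p : ℝ × ℝ) :
      S (bdryVec (kerK t κ) c p) = m (0, 1) • S' (bdryVec (kerK t κ) c p) := by
    by_cases hp2 : p.2 = 0
    · have := hm (1, 0) (by simp)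
      rw [bdryVec_inf rfl, hinf'] at this
      rw [bdryVec_inf hp2, this]
    · rw [bdryVec_fin hp2, hall]
  -- `Sw - mS'w` is orthogonal to the images of all the boundary vectors
  have hSS (w : Model M) : S w = m (0, 1) • S' w := by
    have : S.symm (S w - m (0, 1) • S' w) = 0 := by
      apply h.eq_zero_of_orthogonal
      intro p _
      rw [← UQ_apply hS, LinearEquiv.apply_symm_apply, Q_sub_left, UQ_apply hS, hbdry, Q_smul_left,
        Q_smul_right, UQ_apply hS', ← mul_assoc, hunit]
      ring
    rw [LinearEquiv.map_eq_zero_iff] at this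
    exact sub_eq_zero.1 this
  apply Subtype.ext
  rw [← hxS, ← hyS]
  ext p
  induction p using Projectivization.ind with
  | h v hv =>
    rw [projPerm_mk, projPerm_mk, Projectivization.mk_eq_mk_iff']
    exact ⟨m (0, 1), (hSS v).symm⟩

theorem total_of_mem {c' : ℝ → M} (hc : ∀ b, c b ∈ Submodule.span ℂ (Set.range c')) :
    (Submodule.span ℂ (Set.range c')).topologicalClosure = ⊤ := by
  rw [eq_top_iff, ← h.total]
  apply Submodule.topologicalClosure_mono
  rw [Submodule.span_le]
  rintro _ ⟨b, rfl⟩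
  exact hc b

/-- The unitary part of the unipotent isometry of parameter `b`. -/
theorem exists_unip [CompleteSpace M] (b : ℝ) :
    ∃ U : M ≃ₗᵢ[ℂ] M, ∀ a, U (c a) = c (a + b) - c b := by
  refine exists_isometry_of_gram h.total (h.total_of_mem fun a => ?_) fun i j => ?_
  · have h1 : c (a - b + b) - c b ∈ Submodule.span ℂ (Set.range fun a => c (a + b) - c b) :=
      Submodule.subset_span ⟨a - b, rfl⟩
    have h2 : c (-b + b) - c b ∈ Submodule.span ℂ (Set.range fun a => c (a + b) - c b) :=
      Submodule.subset_span ⟨-b, rfl⟩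
    have := sub_mem h1 h2
    simpa [h.apply_zero] using this
  · rw [inner_sub_left, inner_sub_right, inner_sub_right, h.gram, h.gram, h.gram, h.gram, h.gram]
    have e1 : j + b - (i + b) = j - i := by ring
    have e2 : b - (i + b) = -i := by ring
    have e3 : j + b - b = j := by ring
    rw [e1, e2, e3, sub_self, h.kerK_zero]
    ring

/-- The unitary part of the diagonal isometry of parameter `l`. -/
theorem exists_diag [CompleteSpace M] {l : ℝ} (hl : 0 < l) :
    ∃ U : M ≃ₗᵢ[ℂ] M, ∀ a, U (c a) = ((l ^ t : ℝ) : ℂ)⁻¹ • c (l ^ 2 * a) := by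
  have hlt : ((l ^ t : ℝ) : ℂ) ≠ 0 := by exact_mod_cast (Real.rpow_pos_of_pos hl t).ne'
  refine exists_isometry_of_gram h.total (h.total_of_mem fun a => ?_) fun i j => ?_
  · have h1 : ((l ^ t : ℝ) : ℂ)⁻¹ • c (l ^ 2 * ((l ^ 2)⁻¹ * a)) ∈
        Submodule.span ℂ (Set.range fun a => ((l ^ t : ℝ) : ℂ)⁻¹ • c (l ^ 2 * a)) :=
      Submodule.subset_span ⟨(l ^ 2)⁻¹ * a, rfl⟩
    have h2 := Submodule.smul_mem _ ((l ^ t : ℝ) : ℂ) h1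
    rwa [smul_smul, mul_inv_cancel₀ hlt, one_smul, mul_inv_cancel_left₀ (by positivity)] at h2
  · rw [inner_smul_left, inner_smul_right, h.gram, h.gram, ← mul_neg, ← mul_sub, kerK_sq_mul hl,
      kerK_sq_mul hl, kerK_sq_mul hl, map_inv₀, Complex.conj_ofReal]
    field_simp

/-- The operator `A`: since `K(b)K(-1/b) = |κ|²`, its existence amounts to `kerK_mul_mul`. At `b = 0`
both sides of the formula vanish. -/
theorem exists_swap [CompleteSpace M] : ∃ A : M ≃ₗᵢ[ℂ] M, ∀ b, A (c b) =
    (((‖κ‖⁻¹ : ℝ) : ℂ) * kerK t κ b) • c (-1 / b) := by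
  have hκ : ((‖κ‖ : ℝ) : ℂ) ≠ 0 := by exact_mod_cast norm_ne_zero_iff.2 h.ne_zero
  refine exists_isometry_of_gram h.total (h.total_of_mem fun a => ?_) fun i j => ?_
  · rcases eq_or_ne a 0 with rfl | ha
    · rw [h.apply_zero]; exact zero_mem _
    have ha' : -1 / a ≠ 0 := by simpa using ha
    have e : -1 / (-1 / a) = a := by field_simp
    have hk := kerK_ne_zero (t := t) h.ne_zero ha'
    have h1 : (((‖κ‖⁻¹ : ℝ) : ℂ) * kerK t κ (-1 / a)) • c (-1 / (-1 / a)) ∈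
        Submodule.span ℂ (Set.range fun b => (((‖κ‖⁻¹ : ℝ) : ℂ) * kerK t κ b) • c (-1 / b)) :=
      Submodule.subset_span ⟨-1 / a, rfl⟩
    rw [e] at h1
    exact (Submodule.smul_mem_iff _ (mul_ne_zero (by simpa using h.ne_zero) hk)).1 h1
  · rw [inner_smul_left, inner_smul_right]
    rcases eq_or_ne i 0 with rfl | hi
    · simp [h.apply_zero]
    rcases eq_or_ne j 0 with rfl | hj
    · simp [h.apply_zero]
    rw [h.gram, h.gram, map_mul, Complex.conj_ofReal, ← Complex.star_def, ← kerK_neg h.t_pos.ne']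
    have e1 := kerK_mul_mul (κ := κ) h.t_pos.ne' hj hi
    have e2 := kerK_neg_one_div (κ := κ) (t := t) hj
    have e3 := kerK_neg_one_div (κ := κ) (t := t) (neg_ne_zero.2 hi)
    have e4 : -(-1 / i) = -1 / -i := by field_simp
    have e5 : -1 / j - -1 / i = 1 / i - 1 / j := by ring
    rw [e4, e5]
    generalize kerK t κ (1 / i - 1 / j) = x1 at *
    generalize kerK t κ (-1 / j) = x2 at *
    generalize kerK t κ (-1 / -i) = x3 at *
    push_cast at e1 e2 e3 ⊢
    field_simp
    linear_combination kerK t κ (-i) * e2 + kerK t κ j * e3 - e1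

theorem equivariant_unip {b : ℝ} {π : M ≃ₗᵢ[ℂ] M} (hπ : ∀ a, π (c a) = c (a + b) - c b) :
    IsEquivariant (kerK t κ) c (gP 1 one_pos b)
      (ofUQ _ (unipEquiv_mem (h.add_star b) π)) := by
  refine isEquivariant_unip rfl ⟨1, ?_⟩ fun a => ⟨1, ?_⟩
  · simp [unipEquiv_apply, unipBlock, eta1]
  · simp only [unipEquiv_apply, unipBlock, horoVec, hπ, one_smul, mul_one, inner_sub_right, h.gram,
      Prod.mk.injEq, true_and, sub_self, h.kerK_zero]
    constructor
    · rw [add_sub_cancel_right]; ring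
    · abel

omit h in
theorem equivariant_diag {l : ℝ} {hl : 0 < l} {π : M ≃ₗᵢ[ℂ] M}
    (hπ : ∀ a, π (c a) = ((l ^ t : ℝ) : ℂ)⁻¹ • c (l ^ 2 * a)) :
    IsEquivariant (kerK t κ) c (gP l hl 0)
      (ofUQ _ (diagEquiv_mem (l ^ t) (Real.rpow_pos_of_pos hl t).ne' π)) := by
  have hlt : ((l ^ t : ℝ) : ℂ) ≠ 0 := by exact_mod_cast (Real.rpow_pos_of_pos hl t).ne'
  refine isEquivariant_diag rfl ⟨(l ^ t : ℝ), ?_⟩ fun a => ⟨((l ^ t : ℝ) : ℂ)⁻¹, ?_⟩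
  · simp [diagEquiv_apply, diagBlock, eta1]
  · simp only [diagEquiv_apply, diagBlock, horoVec, hπ, kerK_sq_mul hl, Prod.smul_mk, smul_eq_mul]
    congr 1
    field_simp

theorem equivariant_swap {A : M ≃ₗᵢ[ℂ] M}
    (hA : ∀ b, A (c b) = (((‖κ‖⁻¹ : ℝ) : ℂ) * kerK t κ b) • c (-1 / b)) :
    IsEquivariant (kerK t κ) c sElt
      (ofUQ _ (swapEquiv_mem ‖κ‖⁻¹ (inv_ne_zero (norm_ne_zero_iff.2 h.ne_zero)) A)) := by
  have hκ : ((‖κ‖ : ℝ) : ℂ) ≠ 0 := by exact_mod_cast norm_ne_zero_iff.2 h.ne_zero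
  refine isEquivariant_sElt rfl ⟨(‖κ‖⁻¹ : ℝ), ?_⟩ ⟨‖κ‖, ?_⟩ fun b hb =>
    ⟨((‖κ‖⁻¹ : ℝ) : ℂ) * kerK t κ b, ?_⟩
  · simp [swapEquiv_apply, swapBlock, eta1, h.horoVec_zero, eta2]
  · simp [swapEquiv_apply, swapBlock, eta1, h.horoVec_zero, eta2]
  · simp only [swapEquiv_apply, swapBlock, horoVec, hA, Prod.smul_mk, smul_eq_mul, mul_one]
    congr 1
    have := kerK_neg_one_div (κ := κ) (t := t) hb
    push_cast at this ⊢
    rw [mul_assoc, this]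
    field_simp

theorem exists_equivariant [CompleteSpace M] (g : SU11) :
    ∃ x : PUQ M, IsEquivariant (kerK t κ) c g x := by
  induction g using SU11_induction with
  | hmul g g' hg hg' =>
    obtain ⟨x, hx⟩ := hg
    obtain ⟨y, hy⟩ := hg'
    exact ⟨x * y, hx.mul hy⟩
  | hP l hl b =>
    obtain ⟨U, hU⟩ := h.exists_unip (l * b)
    obtain ⟨V, hV⟩ := h.exists_diag hl
    rw [gP_eq_unip_mul_diag]
    exact ⟨_, (h.equivariant_unip hU).mul (equivariant_diag hV)⟩
  | hs =>
    obtain ⟨A, hA⟩ := h.exists_swap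
    exact ⟨_, h.equivariant_swap hA⟩

/-- The action on the boundary extends to a representation of `PSU(1,1)`. -/
theorem exists_rep [CompleteSpace M] : ∃ ρ : PSU11 →* PUQ M,
    ∀ g, IsEquivariant (kerK t κ) c g (ρ (toPSU g)) := by
  choose T hT using h.exists_equivariant
  let T' : SU11 →* PUQ M := MonoidHom.mk' T fun g g' =>
    h.equivariant_unique (hT _) ((hT g).mul (hT g'))
  have hcenter : Subgroup.center SU11 ≤ T'.ker := by
    intro g hg
    refine h.equivariant_unique (g := 1) (x := T g) (fun p hp => ?_) (fun p hp => ?_)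
    · rw [hT g p hp]
      simp only [bdryVec_of_center hg, bdryAct_one]
    · simp only [bdryAct_one]
      rfl
  exact ⟨QuotientGroup.lift _ T' hcenter, fun g => hT g⟩

theorem swap_involutive {A : M ≃ₗᵢ[ℂ] M}
    (hA : ∀ b, A (c b) = (((‖κ‖⁻¹ : ℝ) : ℂ) * kerK t κ b) • c (-1 / b)) (u : M) :
    A (A u) = u := by
  have hκ : ((‖κ‖ : ℝ) : ℂ) ≠ 0 := by exact_mod_cast norm_ne_zero_iff.2 h.ne_zero
  have : (A.toContinuousLinearEquiv : M →L[ℂ] M).comp (A.toContinuousLinearEquiv : M →L[ℂ] M) =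
      ContinuousLinearMap.id ℂ M := by
    apply eq_of_eqOn_total h.total
    intro b
    rcases eq_or_ne b 0 with rfl | hb
    · simp [h.apply_zero]
    have hk := kerK_neg_one_div (κ := κ) (t := t) hb
    have e : -1 / (-1 / b) = b := by field_simp
    change A (A (c b)) = c b
    rw [hA, map_smul, hA, smul_smul, e]
    convert one_smul ℂ (c b)
    generalize kerK t κ (-1 / b) = x at *
    push_cast at hk ⊢
    field_simp
    linear_combination hk
  exact congrArg (fun f : M →L[ℂ] M => f u) this

end IsHoroCocycle

end Cocycle

/-! ### The representation defined by a horospherical cocycle -/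

section Rep

variable {M : Type*} [NormedAddCommGroup M] [InnerProductSpace ℂ M]

theorem mk_bdryVec_inf {K : ℝ → ℂ} {c : ℝ → M} {p : ℝ × ℝ} (h : p.2 = 0) :
    Projectivization.mk ℂ (bdryVec K c p) (bdryVec_ne_zero K c p) = pt1 M := by
  simp only [bdryVec_inf h, pt1]

theorem hypDist_map (x : PUQ M) (p q : ℙ ℂ (Model M)) : hypDist (x.1 p) (x.1 q) = hypDist p q := by
  obtain ⟨S, hS, hx⟩ := exists_UQ x
  induction p using Projectivization.ind with
  | h v hv =>
    induction q using Projectivization.ind with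
    | h w hw =>
      rw [← hx, projPerm_mk, projPerm_mk, hypDist_mk, hypDist_mk, UQ_apply hS, UQ_apply hS,
        UQ_apply hS]

theorem tendsto_arcosh_one : Filter.Tendsto Real.arcosh (𝓝 1) (𝓝 0) := by
  have : ContinuousAt Real.arcosh 1 := by
    unfold Real.arcosh
    apply ContinuousAt.log
    · fun_prop
    · norm_num
  have h := this.tendsto
  rwa [Real.arcosh_zero] at h

/-- An isotropic eigenvector of a diagonal isometry with `χ ≠ 1` is a multiple
of `η₁` or of `η₂`. -/
theorem isotropic_eigenvector {χ : ℝ} (h0 : 0 < χ) (h1 : χ ≠ 1) {S : Model M ≃ₗ[ℂ] Model M}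
    {π : M → M} (hS : ∀ v, S v = diagBlock χ π v) {v : Model M} (hv : Q v v = 0)
    {a : ℂ} (ha : S v = a • v) : v.2.2 = 0 ∧ (v.1 = 0 ∨ v.2.1 = 0) := by
  rw [hS] at ha
  have e1 : (χ : ℂ) * v.1 = a * v.1 := congrArg Prod.fst ha
  have e2 : (χ : ℂ)⁻¹ * v.2.1 = a * v.2.1 := congrArg (fun w : Model M => w.2.1) ha
  have h12 : v.1 = 0 ∨ v.2.1 = 0 := by
    by_contra! hne
    have e3 := mul_right_cancel₀ hne.1 e1
    have e4 := mul_right_cancel₀ hne.2 e2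
    have hχ : (χ : ℂ) ≠ 0 := by exact_mod_cast h0.ne'
    have e5 : (χ : ℂ) * χ = 1 := by
      have : (χ : ℂ)⁻¹ = χ := e4.trans e3.symm
      calc (χ : ℂ) * χ = (χ : ℂ)⁻¹ * χ := by rw [this]
        _ = 1 := inv_mul_cancel₀ hχ
    have e6 : χ * χ = 1 := by exact_mod_cast e5
    exact h1 (by nlinarith)
  refine ⟨?_, h12⟩
  have hz : v.1 * star v.2.1 = 0 := by rcases h12 with h | h <;> simp [h]
  rw [Q_self, hz] at hv
  simpa using hv

namespace IsHoroCocycle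

variable {t : ℝ} {κ : ℂ} {c : ℝ → M} (h : IsHoroCocycle t κ c)
include h

theorem mk_bdryVec_zero {p : ℝ × ℝ} (hp : p.1 = 0) (hp' : p.2 ≠ 0) :
    Projectivization.mk ℂ (bdryVec (kerK t κ) c p) (bdryVec_ne_zero _ c p) = pt2 M := by
  simp only [bdryVec_fin hp', hp, zero_div, h.horoVec_zero, pt2]

variable {ρ : PSU11 →* PUQ M} (hρ : ∀ g, IsEquivariant (kerK t κ) c g (ρ (toPSU g)))
include hρ

theorem unip_lift {b : ℝ} {π : M ≃ₗᵢ[ℂ] M} (hπ : ∀ a, π (c a) = c (a + b) - c b) :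
    IsNormLift (ρ (toPSU (gP 1 one_pos b))) (unipEquiv (kerK t κ b) (c b) π) := by
  refine ⟨unipEquiv_mem (h.add_star b) π, ?_, 1, one_pos, ?_⟩
  · exact congrArg Subtype.val (h.equivariant_unique (h.equivariant_unip hπ) (hρ _))
  · simp [unipEquiv_apply, unipBlock, eta1]

theorem diag_lift {l : ℝ} {hl : 0 < l} {π : M ≃ₗᵢ[ℂ] M}
    (hπ : ∀ a, π (c a) = ((l ^ t : ℝ) : ℂ)⁻¹ • c (l ^ 2 * a)) :
    IsNormLift (ρ (toPSU (gP l hl 0)))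
      (diagEquiv (l ^ t) (Real.rpow_pos_of_pos hl t).ne' π) := by
  refine ⟨diagEquiv_mem _ _ π, ?_, l ^ t, Real.rpow_pos_of_pos hl t, ?_⟩
  · exact congrArg Subtype.val (h.equivariant_unique (equivariant_diag hπ) (hρ _))
  · simp [diagEquiv_apply, diagBlock, eta1]

theorem swap_lift {A : M ≃ₗᵢ[ℂ] M}
    (hA : ∀ b, A (c b) = (((‖κ‖⁻¹ : ℝ) : ℂ) * kerK t κ b) • c (-1 / b)) :
    projPerm (swapEquiv ‖κ‖⁻¹ (inv_ne_zero (norm_ne_zero_iff.2 h.ne_zero)) A) =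
      (ρ (toPSU sElt)).1 :=
  congrArg Subtype.val (h.equivariant_unique (h.equivariant_swap hA) (hρ _))

theorem hasDistinguishedPoints : HasDistinguishedPoints ρ := by
  constructor
  · intro l hl b
    have h1 := hρ (gP l hl b) (1, 0) (by simp)
    rwa [mk_bdryVec_inf rfl, mk_bdryVec_inf (by simp [bdryAct])] at h1
  · intro l hl
    have h1 := hρ (gP l hl 0) (0, 1) (by simp)
    rwa [h.mk_bdryVec_zero rfl (by simp), h.mk_bdryVec_zero (by simp [bdryAct_diag])
      (by simp [bdryAct_diag, hl.ne'])] at h1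

variable [CompleteSpace M]

theorem hasLength : HasLength ρ t := by
  intro l hl
  obtain ⟨π, hπ⟩ := h.exists_diag hl
  rw [(h.diag_lift hρ hπ).normLift_eq]
  simp [diagEquiv_apply, diagBlock, eta1]

theorem Kfun_eq (b : ℝ) : Kfun ρ b = kerK t κ b := by
  obtain ⟨π, hπ⟩ := h.exists_unip b
  have h1 : normLift (ρ (toPSU (gP 1 one_pos b))) (eta2 M) = (kerK t κ b, 1, c b) := by
    rw [(h.unip_lift hρ hπ).normLift_eq]
    simp [unipEquiv_apply, unipBlock, eta2]
  have h2 := congrArg Complex.re (h.add_star b)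
  rw [Complex.add_re, Complex.star_def, Complex.conj_re, Complex.ofReal_re] at h2
  rw [Kfun, cocyc, delta, h1]
  apply Complex.ext <;> simp [-Complex.ofReal_pow]
  linarith

/-- An invariant hyperbolic subspace contains `η₁` and `η₂`, by the contraction properties of the
diagonal isometries, and hence all the boundary vectors. -/
theorem eq_top_of_invariant {V : Submodule ℂ (Model M)} (hV : IsHyperbolicSubspace V)
    (hinv : ∀ g, ∀ p ∈ hypSpace M, p.rep ∈ V → ((ρ g).1 p).rep ∈ V) : V = ⊤ := by
  obtain ⟨hcl, v, hvV, hv⟩ := hV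
  have hinv' {g : PSU11} {S : Model M ≃ₗ[ℂ] Model M} (hS : projPerm S = (ρ g).1) {w : Model M}
      (hw : 0 < (Q w w).re) (hwV : w ∈ V) : S w ∈ V := by
    rw [← rep_map_mem_iff hS (positive_ne_zero hw)]
    exact hinv g _ ((mk_mem_hypSpace _).2 hw) ((rep_mk_mem_iff _ _).2 hwV)
  have hv12 : v.1 ≠ 0 ∧ v.2.1 ≠ 0 := by
    rw [Q_self, Complex.ofReal_re] at hv
    constructor <;> intro h0 <;> rw [h0] at hv <;> simp at hv <;> nlinarith [sq_nonneg ‖v.2.2‖]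
  choose! π hπ using fun (l : ℝ) (hl : 0 < l) => h.exists_diag hl
  have hdiag (l : ℝ) (hl : 0 < l) : diagBlock (l ^ t) (π l) v ∈ V :=
    hinv' (h.diag_lift hρ (hl := hl) (hπ l hl)).2.1 hv hvV
  have hpi0 (χ : ℝ → ℝ) (hχ : Filter.Tendsto χ Filter.atTop (𝓝 0)) (f : ℝ → ℝ) :
      Filter.Tendsto (fun n => ((χ n : ℝ) : ℂ) • π (f n) v.2.2) Filter.atTop (𝓝 0) := by
    rw [tendsto_zero_iff_norm_tendsto_zero]
    have : Filter.Tendsto (fun n => ‖χ n‖ * ‖v.2.2‖) Filter.atTop (𝓝 0) := by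
      simpa using hχ.norm.mul_const ‖v.2.2‖
    refine this.congr fun n => ?_
    rw [norm_smul, LinearIsometryEquiv.norm_map, Complex.norm_real]
  have hχ : Filter.Tendsto (fun n : ℝ => (n ^ t)⁻¹) Filter.atTop (𝓝 0) :=
    (tendsto_rpow_atTop h.t_pos).inv_tendsto_atTop
  have hχ' : Filter.Tendsto (fun n : ℝ => (((n ^ t)⁻¹ : ℝ) : ℂ)) Filter.atTop (𝓝 0) := by
    exact (Complex.continuous_ofReal.tendsto' 0 0 (by simp)).comp hχ
  -- `l^{-t}ρ(g(l,0))v` tends to a multiple of `η₁` as `l → ∞`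
  have hη1 : eta1 M ∈ V := by
    have hlim : Filter.Tendsto (fun l : ℝ => (((l ^ t)⁻¹ : ℝ) : ℂ) • diagBlock (l ^ t) (π l) v)
        Filter.atTop (𝓝 (v.1, 0, 0)) := by
      simp only [diagBlock, Prod.smul_mk, smul_eq_mul]
      refine Filter.Tendsto.prodMk_nhds ?_ (Filter.Tendsto.prodMk_nhds ?_ (hpi0 _ hχ _))
      · apply tendsto_const_nhds.congr'
        filter_upwards [Filter.eventually_gt_atTop 0] with l hl
        have : ((l ^ t : ℝ) : ℂ) ≠ 0 := by exact_mod_cast (Real.rpow_pos_of_pos hl t).ne'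
        push_cast
        field_simp
      · have := (hχ'.mul hχ').mul_const v.2.1
        simp only [mul_zero, zero_mul] at this
        refine this.congr fun l => ?_
        push_cast
        ring
    have hmem : ((v.1, 0, 0) : Model M) ∈ V := by
      refine hcl.mem_of_tendsto hlim ?_
      filter_upwards [Filter.eventually_gt_atTop 0] with l hl
      exact V.smul_mem _ (hdiag l hl)
    have e : ((v.1, 0, 0) : Model M) = v.1 • eta1 M := by simp [eta1]
    rw [e] at hmem
    exact (V.smul_mem_iff hv12.1).1 hmem
  -- `l^{-t}ρ(g(l⁻¹,0))v` tends to a multiple of `η₂` as `l → ∞`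
  have hη2 : eta2 M ∈ V := by
    have hlim : Filter.Tendsto
        (fun l : ℝ => (((l ^ t)⁻¹ : ℝ) : ℂ) • diagBlock (l⁻¹ ^ t) (π l⁻¹) v)
        Filter.atTop (𝓝 (0, v.2.1, 0)) := by
      simp only [diagBlock, Prod.smul_mk, smul_eq_mul]
      refine Filter.Tendsto.prodMk_nhds ?_ (Filter.Tendsto.prodMk_nhds ?_ (hpi0 _ hχ _))
      · have := (hχ'.mul hχ').mul_const v.1
        simp only [mul_zero, zero_mul] at this
        refine this.congr' ?_
        filter_upwards [Filter.eventually_gt_atTop 0] with l hl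
        rw [Real.inv_rpow hl.le]
        push_cast
        ring
      · apply tendsto_const_nhds.congr'
        filter_upwards [Filter.eventually_gt_atTop 0] with l hl
        have : ((l ^ t : ℝ) : ℂ) ≠ 0 := by exact_mod_cast (Real.rpow_pos_of_pos hl t).ne'
        rw [Real.inv_rpow hl.le]
        push_cast
        field_simp
    have hmem : ((0, v.2.1, 0) : Model M) ∈ V := by
      refine hcl.mem_of_tendsto hlim ?_
      filter_upwards [Filter.eventually_gt_atTop 0] with l hl
      exact V.smul_mem _ (hdiag l⁻¹ (inv_pos.2 hl))
    have e : ((0, v.2.1, 0) : Model M) = v.2.1 • eta2 M := by simp [eta2]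
    rw [e] at hmem
    exact (V.smul_mem_iff hv12.2).1 hmem
  have hc (b : ℝ) : ((0, 0, c b) : Model M) ∈ V := by
    obtain ⟨π, hπ⟩ := h.exists_unip b
    have hpos : 0 < (Q (eta1 M + eta2 M) (eta1 M + eta2 M)).re := by
      simp [Q, eta1, eta2]
    have h1 := hinv' (h.unip_lift hρ hπ).2.1 hpos (add_mem hη1 hη2)
    have h2 := sub_mem (sub_mem h1 (V.smul_mem (1 + kerK t κ b) hη1)) hη2
    convert h2 using 1
    simp [unipEquiv_apply, unipBlock, eta1, eta2]
  have hM (u : M) : ((0, 0, u) : Model M) ∈ V := by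
    let W : Submodule ℂ M := V.comap
      (LinearMap.inr ℂ ℂ (ℂ × M) ∘ₗ LinearMap.inr ℂ ℂ M)
    have hW : (Submodule.span ℂ (Set.range c)).topologicalClosure ≤ W := by
      apply Submodule.topologicalClosure_minimal
      · rw [Submodule.span_le]
        rintro _ ⟨b, rfl⟩
        exact hc b
      · refine hcl.preimage (f := fun u : M => ((0, 0, u) : Model M)) ?_
        fun_prop
    rw [h.total] at hW
    exact hW (Submodule.mem_top (x := u))
  rw [eq_top_iff]
  intro w _
  have : w = w.1 • eta1 M + w.2.1 • eta2 M + (0, 0, w.2.2) := by simp [eta1, eta2]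
  rw [this]
  exact add_mem (add_mem (V.smul_mem _ hη1) (V.smul_mem _ hη2)) (hM _)

/-- The isometry `ρ(g(2,0))` has no other fixed boundary points than the distinguished ones. -/
theorem eq_pt_of_fixed_isotropic {v : Model M} (hv0 : v ≠ 0) (hv : Q v v = 0)
    (hdiag : (ρ (toPSU (gP 2 two_pos 0))).1 (Projectivization.mk ℂ v hv0) =
      Projectivization.mk ℂ v hv0) :
    Projectivization.mk ℂ v hv0 = pt1 M ∨ Projectivization.mk ℂ v hv0 = pt2 M := by
  obtain ⟨π, hπ⟩ := h.exists_diag two_pos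
  have hl := h.diag_lift hρ (hl := two_pos) hπ
  obtain ⟨a, ha⟩ := (map_mk_eq_iff hl.2.1 _ _).1 hdiag
  obtain ⟨h1, h2⟩ := isotropic_eigenvector (Real.rpow_pos_of_pos two_pos t)
    (Real.one_lt_rpow one_lt_two h.t_pos).ne' (fun v => rfl) hv ha
  rcases h2 with h2 | h2
  · right
    rw [pt2, Projectivization.mk_eq_mk_iff']
    exact ⟨v.2.1, Prod.ext (by simp [eta2, h2]) (Prod.ext (by simp [eta2]) (by simp [eta2, h1]))⟩
  · left
    rw [pt1, Projectivization.mk_eq_mk_iff']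
    exact ⟨v.1, Prod.ext (by simp [eta1]) (Prod.ext (by simp [eta1, h2]) (by simp [eta1, h1]))⟩

omit [CompleteSpace M] in
theorem sElt_pt1 : (ρ (toPSU sElt)).1 (pt1 M) = pt2 M := by
  have h1 := hρ sElt (1, 0) (by simp)
  rwa [mk_bdryVec_inf rfl, h.mk_bdryVec_zero (by simp [bdryAct_sElt])
    (by simp [bdryAct_sElt])] at h1

omit [CompleteSpace M] h hρ in
theorem pt1_ne_pt2 : pt1 M ≠ pt2 M := by
  intro e
  rw [pt1, pt2, Projectivization.mk_eq_mk_iff'] at e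
  obtain ⟨a, ha⟩ := e
  have := congrArg Prod.fst ha
  simp [eta1, eta2] at this

omit [CompleteSpace M] in
theorem sElt_pt2 : (ρ (toPSU sElt)).1 (pt2 M) = pt1 M := by
  rw [← h.sElt_pt1 hρ, ← Equiv.Perm.mul_apply, ← Subgroup.coe_mul, ← map_mul, ← map_mul,
    toPSU_sElt_sq, map_one]
  rfl

omit [CompleteSpace M] in
theorem unip_pt2 {b : ℝ} (hb : b ≠ 0) : (ρ (toPSU (gP 1 one_pos b))).1 (pt2 M) ≠ pt2 M := by
  have h1 := hρ (gP 1 one_pos b) (0, 1) (by simp)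
  rw [h.mk_bdryVec_zero rfl (by simp)] at h1
  rw [h1]
  intro h2
  have e : bdryAct (gP 1 one_pos b) (0, 1) = (b, 1) := by simp [bdryAct_unip]
  rw [pt2, Projectivization.mk_eq_mk_iff'] at h2
  obtain ⟨a, ha⟩ := h2
  rw [e, bdryVec_one_right] at ha
  have h3 : (0 : ℂ) = kerK t κ b := by simpa [eta2, horoVec] using congrArg Prod.fst ha
  exact kerK_ne_zero h.ne_zero hb h3.symm

theorem nonElementary : NonElementary ρ := by
  constructor
  · rintro ⟨p, hp | hp, hfix⟩
    · induction p using Projectivization.ind with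
      | h v hv =>
      rw [mk_mem_hypSpace] at hp
      -- a fixed positive line would be an invariant hyperbolic subspace
      have htop : Submodule.span ℂ {v} = ⊤ := by
        refine h.eq_top_of_invariant hρ ⟨Submodule.closed_of_finiteDimensional _, v,
          Submodule.mem_span_singleton_self v, hp⟩ fun g q _ hq => ?_
        induction q using Projectivization.ind with
        | h w hw =>
        rw [rep_mk_mem_iff, Submodule.mem_span_singleton] at hq
        obtain ⟨a, ha⟩ := hq
        have : Projectivization.mk ℂ w hw = Projectivization.mk ℂ v hv := by
          rw [Projectivization.mk_eq_mk_iff']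
          exact ⟨a, ha⟩
        rw [this, hfix, rep_mk_mem_iff]
        exact Submodule.mem_span_singleton_self v
      have h1 : eta1 M ∈ Submodule.span ℂ {v} := htop ▸ Submodule.mem_top
      have h2 : eta2 M ∈ Submodule.span ℂ {v} := htop ▸ Submodule.mem_top
      rw [Submodule.mem_span_singleton] at h1 h2
      obtain ⟨a, ha⟩ := h1
      obtain ⟨b, hb⟩ := h2
      have e1 : a * v.1 = 1 := congrArg Prod.fst ha
      have e2 : b * v.1 = 0 := congrArg Prod.fst hb
      have e3 : b * v.2.1 = 1 := congrArg (fun w : Model M => w.2.1) hb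
      have hb0 : b ≠ 0 := by rintro rfl; simp at e3
      have hv1 : v.1 ≠ 0 := by intro e; simp [e] at e1
      exact mul_ne_zero hb0 hv1 e2
    · induction p using Projectivization.ind with
      | h v hv =>
      rw [mk_mem_hypBoundary] at hp
      rcases h.eq_pt_of_fixed_isotropic hρ hv hp (hfix _) with e | e
      · rw [e] at hfix
        exact pt1_ne_pt2 ((hfix (toPSU sElt)).symm.trans (h.sElt_pt1 hρ))
      · rw [e] at hfix
        exact pt1_ne_pt2 ((h.sElt_pt2 hρ).symm.trans (hfix (toPSU sElt)))
  · rintro ⟨p, hp, q, hq, hpq, hpres⟩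
    -- squares fix both points, and the elements of `P` are squares
    have hsq (g : PSU11) : (ρ (g * g)).1 p = p ∧ (ρ (g * g)).1 q = q := by
      rw [map_mul, Subgroup.coe_mul, Equiv.Perm.mul_apply, Equiv.Perm.mul_apply]
      rcases hpres g with ⟨h1, h2⟩ | ⟨h1, h2⟩ <;> simp [h1, h2]
    have hd : toPSU (gP 2 two_pos 0) =
        toPSU (gP √2 (by positivity) 0) * toPSU (gP √2 (by positivity) 0) := by
      rw [← map_mul, gP_diag_mul]
      congr 1
      exact gP_congr _ _ _ _ (by simp) rfl
    have hu : toPSU (gP 1 one_pos 2) = toPSU (gP 1 one_pos 1) * toPSU (gP 1 one_pos 1) := by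
      rw [← map_mul, gP_unip_mul]
      congr 1
      exact gP_congr _ _ _ _ rfl (by norm_num)
    have key (r : ℙ ℂ (Model M)) (hr : r ∈ hypBoundary M)
        (h1 : (ρ (toPSU (gP 2 two_pos 0))).1 r = r) : r = pt1 M ∨ r = pt2 M := by
      induction r using Projectivization.ind with
      | h v hv => exact h.eq_pt_of_fixed_isotropic hρ hv ((mk_mem_hypBoundary hv).1 hr) h1
    have hp' := key p hp (hd ▸ (hsq _).1)
    have hq' := key q hq (hd ▸ (hsq _).2)
    have h2 := h.unip_pt2 hρ (two_ne_zero' ℝ)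
    rw [hu] at h2
    rcases hp' with rfl | rfl
    · rcases hq' with rfl | rfl
      · exact hpq rfl
      · exact h2 (hsq _).2
    · exact h2 (hsq _).1

theorem isIrreducibleRep : IsIrreducibleRep ρ :=
  ⟨h.nonElementary hρ, fun _ hV hinv => h.eq_top_of_invariant hρ hV hinv⟩

end IsHoroCocycle

end Rep

/-! ### Orbital continuity -/

section Continuity

variable {M : Type*} [NormedAddCommGroup M] [InnerProductSpace ℂ M]

/-- A family of isometries that converges strongly to the identity on a total family does so
everywhere, and jointly with the argument. -/
theorem tendsto_isometry_apply {α ι : Type*} {F : Filter α} {c : ι → M}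
    (hc : (Submodule.span ℂ (Set.range c)).topologicalClosure = ⊤) {π : α → M ≃ₗᵢ[ℂ] M}
    (hπ : ∀ i, Filter.Tendsto (fun j => π j (c i)) F (𝓝 (c i))) {u : α → M} {u₀ : M}
    (hu : Filter.Tendsto u F (𝓝 u₀)) : Filter.Tendsto (fun j => π j (u j)) F (𝓝 u₀) := by
  have hspan : ∀ w ∈ Submodule.span ℂ (Set.range c),
      Filter.Tendsto (fun j => π j w) F (𝓝 w) := by
    intro w hw
    induction hw using Submodule.span_induction with
    | mem x hx => obtain ⟨i, rfl⟩ := hx; exact hπ i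
    | zero => simpa using tendsto_const_nhds
    | add x y _ _ hx hy => simpa using hx.add hy
    | smul a x _ hx => simpa using hx.const_smul a
  have hdense : u₀ ∈ closure (Submodule.span ℂ (Set.range c) : Set M) := by
    rw [← Submodule.topologicalClosure_coe, hc]; trivial
  rw [Metric.tendsto_nhds] at hu ⊢
  intro ε hε
  obtain ⟨w, hw, hwd⟩ := Metric.mem_closure_iff.1 hdense (ε / 4) (by positivity)
  filter_upwards [hu (ε / 4) (by positivity),
    Metric.tendsto_nhds.1 (hspan w hw) (ε / 4) (by positivity)] with j h1 h2
  calc dist (π j (u j)) u₀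
      ≤ dist (π j (u j)) (π j u₀) + dist (π j u₀) (π j w) + dist (π j w) w + dist w u₀ := by
        linarith [dist_triangle (π j (u j)) (π j u₀) u₀, dist_triangle (π j u₀) (π j w) u₀,
          dist_triangle (π j w) w u₀]
    _ < ε := by
        rw [LinearIsometryEquiv.dist_map, LinearIsometryEquiv.dist_map, dist_comm w u₀]
        linarith

theorem swapEquiv_continuous {ν : ℝ} (hν : ν ≠ 0) (A : M ≃ₗᵢ[ℂ] M) :
    Continuous (swapEquiv ν hν A) := by
  change Continuous (swapBlock ν A)
  unfold swapBlock
  fun_prop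

theorem continuous_entry (i j : Fin 2) : Continuous fun g : SU11 => entry g i j := by
  have h1 : Continuous fun g : SU11 => g.1 := continuous_subtype_val
  have h2 : Continuous fun g : SU11 => (g.1 : Matrix (Fin 2) (Fin 2) ℂ) :=
    continuous_subtype_val.comp h1
  exact h2.matrix_elem i j

namespace IsHoroCocycle

variable {t : ℝ} {κ : ℂ} {c : ℝ → M} (h : IsHoroCocycle t κ c)
include h

theorem tendsto_unip {α : Type*} {F : Filter α} {π : ℝ → M ≃ₗᵢ[ℂ] M}
    (hπ : ∀ b a, π b (c a) = c (a + b) - c b) {β : α → ℝ} (hβ : Filter.Tendsto β F (𝓝 0))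
    {u : α → Model M} {u₀ : Model M} (hu : Filter.Tendsto u F (𝓝 u₀)) :
    Filter.Tendsto (fun j => unipBlock (kerK t κ (β j)) (c (β j)) (π (β j)) (u j)) F (𝓝 u₀) := by
  have hc : Filter.Tendsto (fun j => c (β j)) F (𝓝 0) :=
    (h.continuous.tendsto' 0 0 h.apply_zero).comp hβ
  have hK : Filter.Tendsto (fun j => kerK t κ (β j)) F (𝓝 0) := by
    rw [tendsto_zero_iff_norm_tendsto_zero]
    have h1 : Continuous fun x : ℝ => |x| ^ t * ‖κ‖ :=
      ((Real.continuous_rpow_const h.t_pos.le).comp continuous_abs).mul continuous_const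
    have h2 := (h1.tendsto' 0 0 (by simp [Real.zero_rpow h.t_pos.ne'])).comp hβ
    refine h2.congr fun j => ?_
    rw [norm_kerK]; rfl
  have hpi : Filter.Tendsto (fun j => π (β j) (u j).2.2) F (𝓝 u₀.2.2) := by
    refine tendsto_isometry_apply h.total (π := fun j => π (β j)) (fun a => ?_)
      ((continuous_snd.comp continuous_snd).tendsto _ |>.comp hu)
    simp only [hπ]
    have h3 : Filter.Tendsto (fun j => c (a + β j)) F (𝓝 (c a)) := by
      have : Continuous fun x => c (a + x) := h.continuous.comp (continuous_const_add a)
      exact (this.tendsto' 0 (c a) (by simp)).comp hβ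
    simpa using h3.sub hc
  have h1 : Filter.Tendsto (fun j => (u j).1) F (𝓝 u₀.1) := (continuous_fst.tendsto _).comp hu
  have h2 : Filter.Tendsto (fun j => (u j).2.1) F (𝓝 u₀.2.1) :=
    ((continuous_fst.comp continuous_snd).tendsto _).comp hu
  have e1 := (h1.add (hK.mul h2)).add (hc.inner hpi (𝕜 := ℂ))
  have e3 := (h2.smul hc).add hpi
  simp only [zero_mul, add_zero, inner_zero_left, smul_zero, zero_add] at e1 e3
  exact e1.prodMk_nhds (h2.prodMk_nhds e3)

theorem tendsto_diag {α : Type*} {F : Filter α} {π : ℝ → M ≃ₗᵢ[ℂ] M}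
    (hπ : ∀ l, 0 < l → ∀ a, π l (c a) = ((l ^ t : ℝ) : ℂ)⁻¹ • c (l ^ 2 * a)) {β : α → ℝ}
    (hβ : Filter.Tendsto β F (𝓝 1)) (v : Model M) :
    Filter.Tendsto (fun j => diagBlock (β j ^ t) (π (β j)) v) F (𝓝 v) := by
  have hχ : Filter.Tendsto (fun j => ((β j ^ t : ℝ) : ℂ)) F (𝓝 1) := by
    have h1 : Filter.Tendsto (fun j => β j ^ t) F (𝓝 (1 ^ t)) :=
      hβ.rpow_const (Or.inl one_ne_zero)
    rw [Real.one_rpow] at h1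
    exact (Complex.continuous_ofReal.tendsto' 1 1 (by simp)).comp h1
  have hχ' := hχ.inv₀ one_ne_zero
  have hpi : Filter.Tendsto (fun j => π (β j) v.2.2) F (𝓝 v.2.2) := by
    refine tendsto_isometry_apply h.total (π := fun j => π (β j)) (fun a => ?_)
      tendsto_const_nhds
    have h2 : Filter.Tendsto (fun j => c (β j ^ 2 * a)) F (𝓝 (c a)) := by
      have : Continuous fun x : ℝ => c (x ^ 2 * a) := h.continuous.comp (by fun_prop)
      exact (this.tendsto' 1 (c a) (by simp)).comp hβ
    have h3 := hχ'.smul h2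
    rw [inv_one, one_smul] at h3
    refine h3.congr' ?_
    filter_upwards [hβ.eventually (lt_mem_nhds one_pos)] with j hj
    rw [hπ _ hj]
  have e1 := hχ.mul_const v.1
  have e2 := hχ'.mul_const v.2.1
  rw [one_mul] at e1
  rw [inv_one, one_mul] at e2
  exact e1.prodMk_nhds (e2.prodMk_nhds hpi)

variable [CompleteSpace M] {ρ : PSU11 →* PUQ M}
  (hρ : ∀ g, IsEquivariant (kerK t κ) c g (ρ (toPSU g)))
include hρ

/-- Near the identity, `sg = g(1,x) s g(1,y) g(l,0)` with `x, y → 0` and `l → 1`, and the block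
isometries depend strongly continuously on their parameters. The distance is computed after applying `ρ(s)`,
and `ρ(g(1,x))` is moved to the other argument of `Q`. -/
theorem tendsto_hypDist_one {v : Model M} (hv : 0 < (Q v v).re) :
    Filter.Tendsto (fun g : SU11 =>
      hypDist ((ρ (toPSU g)).1 (Projectivization.mk ℂ v (positive_ne_zero hv)))
        (Projectivization.mk ℂ v (positive_ne_zero hv))) (𝓝 1) (𝓝 0) := by
  choose πu hπu using h.exists_unip
  choose! πd hπd using fun (l : ℝ) (hl : 0 < l) => h.exists_diag hl
  obtain ⟨A, hA⟩ := h.exists_swap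
  set ν : ℝ := ‖κ‖⁻¹
  have hν : ν ≠ 0 := inv_ne_zero (norm_ne_zero_iff.2 h.ne_zero)
  let a : SU11 → ℝ := fun g => (entry g 0 0).re
  let b : SU11 → ℝ := fun g => (entry g 0 1).im
  let d : SU11 → ℝ := fun g => (entry g 1 0).im
  have ha : Filter.Tendsto a (𝓝 1) (𝓝 1) :=
    (Complex.continuous_re.comp (continuous_entry 0 0)).tendsto' 1 1 (by simp [entry_one])
  have hb : Filter.Tendsto b (𝓝 1) (𝓝 0) :=
    (Complex.continuous_im.comp (continuous_entry 0 1)).tendsto' 1 0 (by simp [entry_one])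
  have hd : Filter.Tendsto d (𝓝 1) (𝓝 0) :=
    (Complex.continuous_im.comp (continuous_entry 1 0)).tendsto' 1 0 (by simp [entry_one])
  have hab : Filter.Tendsto (fun g => a g * b g) (𝓝 1) (𝓝 0) := by simpa using ha.mul hb
  have hda : Filter.Tendsto (fun g => d g / a g) (𝓝 1) (𝓝 0) := by
    have := hd.div ha one_ne_zero
    rwa [zero_div] at this
  have hda' : Filter.Tendsto (fun g => -(d g / a g)) (𝓝 1) (𝓝 0) := by simpa using hda.neg
  have hS := swapEquiv_continuous hν A
  have t1 := (hS.tendsto v).comp (h.tendsto_unip hπu hab (h.tendsto_diag hπd ha v))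
  have t2 := h.tendsto_unip hπu hda' (tendsto_const_nhds (x := swapEquiv ν hν A v))
  have t3 := (continuous_Q.tendsto _).comp (t1.prodMk_nhds t2)
  have t4 : Filter.Tendsto (fun x : ℂ => ‖x‖ / (Q v v).re) (𝓝 (Q v v)) (𝓝 1) := by
    have : Continuous fun x : ℂ => ‖x‖ / (Q v v).re := by fun_prop
    refine this.tendsto' _ _ ?_
    rw [Q_self_eq_re, Complex.norm_real, Complex.ofReal_re, Real.norm_of_nonneg hv.le,
      div_self hv.ne']
  dsimp only at t3
  rw [UQ_apply (swapEquiv_mem ν hν A)] at t3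
  refine (tendsto_arcosh_one.comp (t4.comp t3)).congr' ?_
  filter_upwards [ha.eventually (lt_mem_nhds one_pos)] with g hg
  have eg : sElt * g = gP 1 one_pos (d g / a g) *
      (sElt * (gP 1 one_pos (a g * b g) * gP (a g) hg 0)) := by
    obtain ⟨a', b', c', d', e1, e2, e3, e4, -⟩ := exists_entries g
    apply sElt_mul_eq_of_pos g
    · simp [a, e1]
    · simp [b, e2]
    · simp [d, e3]
  have hU1 := h.unip_lift hρ (hπu (d g / a g))
  have hU1' := h.unip_lift hρ (hπu (-(d g / a g)))
  have hU2 := h.unip_lift hρ (hπu (a g * b g))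
  have hD := h.diag_lift hρ (hl := hg) (hπd (a g) hg)
  have hsw := h.swap_lift hρ hA
  have hswm := swapEquiv_mem ν hν A
  have hmem := mul_mem hU1.1 (mul_mem hswm (mul_mem hU2.1 hD.1))
  have hperm : projPerm (unipEquiv (kerK t κ (d g / a g)) (c (d g / a g)) (πu (d g / a g)) *
      (swapEquiv ν hν A * (unipEquiv (kerK t κ (a g * b g)) (c (a g * b g)) (πu (a g * b g)) *
      diagEquiv (a g ^ t) (Real.rpow_pos_of_pos hg t).ne' (πd (a g))))) =
      (ρ (toPSU (sElt * g))).1 := by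
    rw [eg]
    simp only [map_mul, Subgroup.coe_mul]
    rw [hU1.2.1, hU2.2.1, hD.2.1, hsw]
  have hcancel (w : Model M) : unipEquiv (kerK t κ (-(d g / a g))) (c (-(d g / a g)))
      (πu (-(d g / a g))) w =
      (unipEquiv (kerK t κ (d g / a g)) (c (d g / a g)) (πu (d g / a g))).symm w := by
    rw [LinearEquiv.eq_symm_apply]
    have h1 := hU1.mul hU1'
    rw [← map_mul, ← map_mul, gP_unip_mul, add_neg_cancel, gP_one_zero, map_one, map_one] at h1
    have h2 : IsNormLift (1 : PUQ M) 1 := ⟨one_mem _, map_one _, 1, one_pos, by simp⟩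
    have := h1.unique h2
    exact congrArg (fun S : Model M ≃ₗ[ℂ] Model M => S w) this
  rw [← hypDist_map (ρ (toPSU sElt)), ← Equiv.Perm.mul_apply, ← Subgroup.coe_mul, ← map_mul,
    ← map_mul, hypDist_map_map hmem hswm hperm hsw hv]
  simp only [Function.comp_apply, LinearEquiv.mul_apply]
  rw [UQ_symm hU1.1, ← hcancel]
  rfl

theorem orbContinuous : OrbContinuous ρ := by
  intro p hp g₀
  obtain ⟨g₀, rfl⟩ := QuotientGroup.mk_surjective g₀
  induction p using Projectivization.ind with
  | h v hv =>
  rw [mk_mem_hypSpace] at hp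
  have h1 := h.tendsto_hypDist_one hρ hp
  have h2 : Filter.Tendsto (fun g : SU11 => g₀⁻¹ * g) (𝓝 g₀) (𝓝 1) :=
    (continuous_const_mul g₀⁻¹).tendsto' _ _ (by simp)
  rw [QuotientGroup.nhds_eq, Filter.tendsto_map'_iff]
  refine (h1.comp h2).congr fun g => ?_
  simp only [Function.comp_apply]
  rw [← hypDist_map (ρ (toPSU g₀)), ← Equiv.Perm.mul_apply, ← Subgroup.coe_mul, ← map_mul,
    ← map_mul, mul_inv_cancel_left]
  rfl

end IsHoroCocycle

end Continuity

/-! ### The parabolic data of a representation -/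

section Data

variable {M : Type*} [NormedAddCommGroup M] [InnerProductSpace ℂ M]

theorem eq_blocks (S : Model M ≃ₗ[ℂ] Model M) (v : Model M) :
    S v = v.1 • S (eta1 M) + v.2.1 • S (eta2 M) + S (0, 0, v.2.2) := by
  rw [← map_smul, ← map_smul, ← map_add, ← map_add]
  congr 1
  simp [eta1, eta2]

theorem norm_eq_of_UQ {S : Model M ≃ₗ[ℂ] Model M} (hS : S ∈ UQ M) {u : M}
    (h : (S (0, 0, u)).2.1 = 0) : ‖(S (0, 0, u)).2.2‖ = ‖u‖ := by
  have h1 := UQ_apply hS (0, 0, u) (0, 0, u)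
  rw [Q_self, Q_self, h] at h1
  have h2 := Complex.ofReal_injective h1
  simp at h2
  exact h2

variable {ρ : PSU11 →* PUQ M} (hpts : HasDistinguishedPoints ρ)
include hpts

theorem exists_lift (l : ℝ) (hl : 0 < l) (b : ℝ) :
    ∃ S, IsNormLift (ρ (toPSU (gP l hl b))) S :=
  exists_isNormLift (hpts.1 l hl b)

theorem diag_blocks {t : ℝ} (hlen : HasLength ρ t) {l : ℝ} {hl : 0 < l}
    {S : Model M ≃ₗ[ℂ] Model M} (hS : IsNormLift (ρ (toPSU (gP l hl 0))) S) (v : Model M) :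
    S v = diagBlock (l ^ t) (unitaryPart ρ l hl 0) v := by
  have hχ : ((l ^ t : ℝ) : ℂ) ≠ 0 := by exact_mod_cast (Real.rpow_pos_of_pos hl t).ne'
  have h1 : S (eta1 M) = ((l ^ t : ℝ) : ℂ) • eta1 M := by rw [← hS.normLift_eq, hlen]
  have hsnd := snd_of_map_eta1 hS.1 h1
  obtain ⟨a, ha⟩ := (map_mk_eq_iff hS.2.1 _ _).1 (hpts.2 l hl)
  have ha' : ((l ^ t : ℝ) : ℂ) * a = 1 := by
    have := hsnd (eta2 M)
    rw [ha] at this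
    simpa [eta2] using this
  have hfst (w : Model M) : (S w).1 * star a = w.1 := by
    have := UQ_apply hS.1 w (eta2 M)
    rw [ha, Q_smul_right, Q_eta2_right, Q_eta2_right] at this
    rw [← this, mul_comm]
  have hainv : a = (((l ^ t)⁻¹ : ℝ) : ℂ) := by
    push_cast
    exact eq_inv_of_mul_eq_one_right ha'
  have h2 := hfst v
  have h3 := hsnd v
  rw [hainv, Complex.star_def, Complex.conj_ofReal] at h2
  push_cast at h2
  refine Prod.ext ?_ (Prod.ext ?_ ?_)
  · simp only [diagBlock]
    rw [← h2]
    field_simp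
  · simp only [diagBlock]
    rw [← h3]
    field_simp
  · simp only [diagBlock, unitaryPart]
    rw [hS.normLift_eq, eq_blocks S v, h1, ha]
    simp [eta1, eta2]

omit hpts in
theorem eq_of_lift_diag_mul_unip {l : ℝ} {hl : 0 < l} {b : ℝ} {S U U' : Model M ≃ₗ[ℂ] Model M}
    (hS : IsNormLift (ρ (toPSU (gP l hl 0))) S) (hU : IsNormLift (ρ (toPSU (gP 1 one_pos b))) U)
    (hU' : IsNormLift (ρ (toPSU (gP 1 one_pos (l ^ 2 * b)))) U') : S * U = U' * S := by
  have h1 := hS.mul hU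
  have h2 := hU'.mul hS
  rw [← map_mul, ← map_mul, gP_diag_mul_unip] at h1
  rw [← map_mul, ← map_mul] at h2
  exact h1.unique h2

/-- The unipotent isometries fix the vector `η₁`, because each of them is conjugate to its square
by a diagonal isometry. -/
theorem unip_eta1 {b : ℝ} {U : Model M ≃ₗ[ℂ] Model M}
    (hU : IsNormLift (ρ (toPSU (gP 1 one_pos b))) U) : U (eta1 M) = eta1 M := by
  obtain ⟨S, hS⟩ := exists_lift hpts √2 (by positivity) 0
  have h2b : IsNormLift (ρ (toPSU (gP 1 one_pos (√2 ^ 2 * b)))) (U * U) := by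
    have := hU.mul hU
    rw [← map_mul, ← map_mul, gP_unip_mul, ← two_mul] at this
    rwa [Real.sq_sqrt zero_le_two]
  have h := congrArg (fun T : Model M ≃ₗ[ℂ] Model M => T (eta1 M))
    (eq_of_lift_diag_mul_unip hS hU h2b)
  obtain ⟨r, hr, hr1⟩ := hU.2.2
  obtain ⟨q, hq, hq1⟩ := hS.2.2
  simp only [LinearEquiv.mul_apply, hr1, hq1, map_smul, smul_smul] at h
  have h3 : (r : ℂ) * q = q * (r * r) := by
    simpa [eta1] using congrArg Prod.fst h
  have h4 : r * q = q * (r * r) := by exact_mod_cast h3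
  have h5 : r = 1 := by
    have : r * q * (r - 1) = 0 := by linarith
    rcases mul_eq_zero.1 this with h | h
    · exact absurd h (mul_pos hr hq).ne'
    · linarith
  rw [hr1, h5]
  simp

/-- Since `Uη₂` is isotropic, the real part of its `η₁`-component is `‖c(b)‖²/2`, so that this
component is `K(b)`. -/
theorem unip_eta2 {b : ℝ} {U : Model M ≃ₗ[ℂ] Model M}
    (hU : IsNormLift (ρ (toPSU (gP 1 one_pos b))) U) :
    U (eta2 M) = horoVec (Kfun ρ) (cocyc ρ) b := by
  have h1 : (U (eta2 M)).2.1 = 1 := by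
    have := snd_of_map_eta1 (r := 1) hU.1 (by rw [unip_eta1 hpts hU]; simp) (eta2 M)
    simpa [eta2] using this
  have hc : cocyc ρ b = (U (eta2 M)).2.2 := by rw [cocyc, hU.normLift_eq]
  have hd : delta ρ b = (U (eta2 M)).1.im := by rw [delta, hU.normLift_eq]
  have hQ := UQ_apply hU.1 (eta2 M) (eta2 M)
  rw [Q_self, h1, Q_eta2_right] at hQ
  have hQ' : 2 * (U (eta2 M)).1.re - ‖(U (eta2 M)).2.2‖ ^ 2 = 0 := by
    have : (((2 * ((U (eta2 M)).1 * star 1).re - ‖(U (eta2 M)).2.2‖ ^ 2 : ℝ)) : ℂ) =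
      ((0 : ℝ) : ℂ) := by rw [hQ]; simp [eta2]
    have := Complex.ofReal_injective this
    simpa using this
  refine Prod.ext ?_ (Prod.ext h1 hc.symm)
  rw [horoVec, Kfun, hc, hd]
  apply Complex.ext
  · simp [-Complex.ofReal_pow]
    linarith
  · simp [-Complex.ofReal_pow]

theorem unip_blocks {b : ℝ} {U : Model M ≃ₗ[ℂ] Model M}
    (hU : IsNormLift (ρ (toPSU (gP 1 one_pos b))) U) (v : Model M) :
    U v = unipBlock (Kfun ρ b) (cocyc ρ b) (unitaryPart ρ 1 one_pos b) v := by
  have h1 := unip_eta1 hpts hU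
  have h2 := unip_eta2 hpts hU
  have h21 : (U (0, 0, v.2.2)).2.1 = 0 := by
    have := snd_of_map_eta1 (r := 1) hU.1 (by rw [h1]; simp) (0, 0, v.2.2)
    simpa using this
  have h11 : (U (0, 0, v.2.2)).1 = inner ℂ (cocyc ρ b) (unitaryPart ρ 1 one_pos b v.2.2) := by
    have := UQ_apply hU.1 (0, 0, v.2.2) (eta2 M)
    rw [h2, Q_eta2_right, Q, h21, unitaryPart] at *
    rw [hU.normLift_eq]
    simp only [horoVec, star_one, mul_one, zero_mul, add_zero] at this
    exact sub_eq_zero.1 this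
  rw [eq_blocks U v, h1, h2]
  refine Prod.ext ?_ (Prod.ext ?_ ?_)
  · simp [eta1, horoVec, unipBlock, h11, mul_comm]
  · simp [eta1, horoVec, unipBlock, h21]
  · simp [eta1, horoVec, unipBlock, unitaryPart, hU.normLift_eq]

theorem unip_horoVec {a : ℝ} {U : Model M ≃ₗ[ℂ] Model M}
    (hU : IsNormLift (ρ (toPSU (gP 1 one_pos a))) U) (b : ℝ) :
    U (horoVec (Kfun ρ) (cocyc ρ) b) = horoVec (Kfun ρ) (cocyc ρ) (a + b) := by
  obtain ⟨U', hU'⟩ := exists_lift hpts 1 one_pos b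
  have h := hU.mul hU'
  rw [← map_mul, ← map_mul, gP_unip_mul] at h
  rw [← unip_eta2 hpts h, ← unip_eta2 hpts hU']
  rfl

theorem horoVec_data_zero : horoVec (Kfun ρ) (cocyc ρ) 0 = eta2 M := by
  have h : IsNormLift (ρ (toPSU (gP 1 one_pos 0))) 1 := by
    rw [gP_one_zero, map_one, map_one]
    exact ⟨one_mem _, map_one _, 1, one_pos, by simp⟩
  rw [← unip_eta2 hpts h]
  rfl

theorem Kfun_zero : Kfun ρ 0 = 0 := congrArg Prod.fst (horoVec_data_zero hpts)

theorem Q_horoVec_data (a b : ℝ) : Q (horoVec (Kfun ρ) (cocyc ρ) a)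
    (horoVec (Kfun ρ) (cocyc ρ) b) = Kfun ρ (a - b) := by
  obtain ⟨U, hU⟩ := exists_lift hpts 1 one_pos b
  have h1 := unip_horoVec hpts hU (a - b)
  have h2 := unip_horoVec hpts hU 0
  rw [add_sub_cancel] at h1
  rw [add_zero] at h2
  rw [← h1, ← h2, UQ_apply hU.1, horoVec_data_zero hpts, Q_eta2_right]
  rfl

theorem Kfun_neg (b : ℝ) : Kfun ρ (-b) = star (Kfun ρ b) := by
  have h1 := Q_horoVec_data hpts 0 b
  rw [horoVec_data_zero hpts, Q_eta2_left, zero_sub] at h1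
  exact h1.symm

theorem inner_cocyc (a b : ℝ) : inner ℂ (cocyc ρ b) (cocyc ρ a) =
    Kfun ρ a + Kfun ρ (-b) - Kfun ρ (a - b) := by
  rw [← Q_horoVec_data hpts a b, Kfun_neg hpts, horoVec, horoVec, Q_mk]
  simp

omit hpts in
theorem Kfun_re (b : ℝ) : (Kfun ρ b).re = ‖cocyc ρ b‖ ^ 2 / 2 := by
  simp [Kfun, -Complex.ofReal_pow]

theorem diag_horoVec {t : ℝ} (hlen : HasLength ρ t) {l : ℝ} {hl : 0 < l}
    {S : Model M ≃ₗ[ℂ] Model M} (hS : IsNormLift (ρ (toPSU (gP l hl 0))) S) (b : ℝ) :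
    S (horoVec (Kfun ρ) (cocyc ρ) b) =
      ((l ^ t : ℝ) : ℂ)⁻¹ • horoVec (Kfun ρ) (cocyc ρ) (l ^ 2 * b) := by
  obtain ⟨U, hU⟩ := exists_lift hpts 1 one_pos b
  obtain ⟨U', hU'⟩ := exists_lift hpts 1 one_pos (l ^ 2 * b)
  have h := congrArg (fun T : Model M ≃ₗ[ℂ] Model M => T (eta2 M))
    (eq_of_lift_diag_mul_unip hS hU hU')
  simp only [LinearEquiv.mul_apply] at h
  have h2 : S (eta2 M) = ((l ^ t : ℝ) : ℂ)⁻¹ • eta2 M := by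
    rw [diag_blocks hpts hlen hS]
    have h0 : unitaryPart ρ l hl 0 0 = 0 := by
      rw [unitaryPart, hS.normLift_eq]
      have : ((0, 0, 0) : Model M) = 0 := rfl
      rw [this, map_zero]; rfl
    simp [diagBlock, eta2, h0]
  rw [unip_eta2 hpts hU, h2, map_smul, unip_eta2 hpts hU'] at h
  exact h

theorem Kfun_sq_mul {t : ℝ} (hlen : HasLength ρ t) {l : ℝ} (hl : 0 < l) (b : ℝ) :
    Kfun ρ (l ^ 2 * b) = ((l ^ t : ℝ) : ℂ) ^ 2 * Kfun ρ b := by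
  have hχ : ((l ^ t : ℝ) : ℂ) ≠ 0 := by exact_mod_cast (Real.rpow_pos_of_pos hl t).ne'
  obtain ⟨S, hS⟩ := exists_lift hpts l hl 0
  have h := congrArg Prod.fst (diag_horoVec hpts hlen hS b)
  rw [diag_blocks hpts hlen hS] at h
  simp only [diagBlock, horoVec, Prod.smul_fst, smul_eq_mul] at h
  rw [sq ((l ^ t : ℝ) : ℂ), mul_assoc, h, mul_inv_cancel_left₀ hχ]

/-- By homogeneity, `K` is determined by `t` and `K(1)`. -/
theorem Kfun_eq_kerK {t : ℝ} (ht : t ≠ 0) (hlen : HasLength ρ t) : Kfun ρ = kerK t (Kfun ρ 1) := by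
  have hpos {x : ℝ} (hx : 0 < x) : Kfun ρ x = kerK t (Kfun ρ 1) x := by
    have h1 := Kfun_sq_mul hpts hlen (Real.sqrt_pos.2 hx) 1
    have h2 := kerK_sq_mul (t := t) (κ := Kfun ρ 1) (Real.sqrt_pos.2 hx) 1
    rw [kerK_one] at h2
    rw [Real.sq_sqrt hx.le, mul_one] at h1 h2
    rw [h1, h2]
  funext x
  rcases lt_trichotomy x 0 with h | rfl | h
  · rw [← neg_neg x, Kfun_neg hpts, kerK_neg ht, hpos (by linarith)]
  · rw [Kfun_zero hpts, kerK_zero ht]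
  · exact hpos h

theorem unitaryPart_unip_cocyc (a b : ℝ) :
    unitaryPart ρ 1 one_pos b (cocyc ρ a) = cocyc ρ (a + b) - cocyc ρ b := by
  obtain ⟨U, hU⟩ := exists_lift hpts 1 one_pos b
  have h := congrArg (fun v : Model M => v.2.2) (unip_horoVec hpts hU a)
  rw [unip_blocks hpts hU] at h
  simp only [unipBlock, horoVec, one_smul] at h
  rw [add_comm a b, ← h]
  abel

theorem unitaryPart_diag_cocyc {t : ℝ} (hlen : HasLength ρ t) {l : ℝ} (hl : 0 < l) (a : ℝ) :
    unitaryPart ρ l hl 0 (cocyc ρ a) = ((l ^ t : ℝ) : ℂ)⁻¹ • cocyc ρ (l ^ 2 * a) := by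
  obtain ⟨S, hS⟩ := exists_lift hpts l hl 0
  have h := congrArg (fun v : Model M => v.2.2) (diag_horoVec hpts hlen hS a)
  rw [diag_blocks hpts hlen hS] at h
  exact h

theorem exists_unitaryPart (l : ℝ) (hl : 0 < l) (b : ℝ) :
    ∃ π : M →L[ℂ] M, ∀ u, π u = unitaryPart ρ l hl b u := by
  obtain ⟨S, hS⟩ := exists_lift hpts l hl b
  obtain ⟨r, hr, hr1⟩ := hS.2.2
  have hr0 : (r : ℂ) ≠ 0 := by exact_mod_cast hr.ne'
  let π : M →ₗ[ℂ] M := LinearMap.snd ℂ ℂ M ∘ₗ LinearMap.snd ℂ ℂ (ℂ × M) ∘ₗ S.toLinearMap ∘ₗ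
    LinearMap.inr ℂ ℂ (ℂ × M) ∘ₗ LinearMap.inr ℂ ℂ M
  have hπ (u : M) : π u = (S (0, 0, u)).2.2 := rfl
  refine ⟨π.mkContinuous 1 fun u => ?_, fun u => ?_⟩
  · rw [one_mul, hπ, norm_eq_of_UQ hS.1]
    have := snd_of_map_eta1 hS.1 hr1 (0, 0, u)
    simpa [hr0] using this
  · rw [unitaryPart, hS.normLift_eq]
    rfl

end Data

/-! ### The cocycle of an irreducible representation -/

section Irreducible

variable {M : Type*} [NormedAddCommGroup M] [InnerProductSpace ℂ M]

/-- For `χ ≠ 1`, the eigenvectors of a diagonal isometry for an eigenvalue of modulus `χ` or `χ⁻¹`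
are the multiples of `η₁` or `η₂`. -/
theorem eigenvector_diagBlock {χ : ℝ} (h0 : 0 < χ) (h1 : χ ≠ 1) {π : M → M}
    (hπ : ∀ u, ‖π u‖ = ‖u‖) {w : Model M} {β : ℂ} (hw : diagBlock χ π w = β • w) :
    (‖β‖ = χ → ∃ a : ℂ, w = a • eta1 M) ∧ (‖β‖ = χ⁻¹ → ∃ a : ℂ, w = a • eta2 M) := by
  have e1 : ‖β‖ * ‖w.1‖ = χ * ‖w.1‖ := by
    have : (χ : ℂ) * w.1 = β * w.1 := congrArg Prod.fst hw
    rw [← norm_mul, ← this, norm_mul, Complex.norm_real, Real.norm_of_nonneg h0.le]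
  have e2 : ‖β‖ * ‖w.2.1‖ = χ⁻¹ * ‖w.2.1‖ := by
    have : (χ : ℂ)⁻¹ * w.2.1 = β * w.2.1 := congrArg (fun w : Model M => w.2.1) hw
    rw [← norm_mul, ← this, norm_mul, norm_inv, Complex.norm_real, Real.norm_of_nonneg h0.le]
  have e3 : ‖β‖ * ‖w.2.2‖ = 1 * ‖w.2.2‖ := by
    have : π w.2.2 = β • w.2.2 := congrArg (fun w : Model M => w.2.2) hw
    rw [← norm_smul, ← this, hπ, one_mul]
  have hne : χ ≠ χ⁻¹ := by
    intro h
    have : χ * χ = 1 := by nth_rewrite 2 [h]; exact mul_inv_cancel₀ h0.ne'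
    exact h1 (by nlinarith)
  have hinv : χ⁻¹ ≠ 1 := fun h => h1 (inv_eq_one.1 h)
  have key {x y z : ℝ} (h : x * z = y * z) (hxy : x ≠ y) : z = 0 := by
    by_contra hz
    exact hxy (mul_right_cancel₀ hz h)
  constructor <;> intro hβ <;> rw [hβ] at e1 e2 e3
  · have z2 := norm_eq_zero.1 (key e2 hne)
    have z3 := norm_eq_zero.1 (key e3 h1)
    exact ⟨w.1, Prod.ext (by simp [eta1]) (Prod.ext (by simp [eta1, z2]) (by simp [eta1, z3]))⟩
  · have z1 := norm_eq_zero.1 (key e1 hne.symm)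
    have z3 := norm_eq_zero.1 (key e3 hinv)
    exact ⟨w.2.1, Prod.ext (by simp [eta2, z1]) (Prod.ext (by simp [eta2]) (by simp [eta2, z3]))⟩

variable {ρ : PSU11 →* PUQ M} (hpts : HasDistinguishedPoints ρ) {t : ℝ} (hlen : HasLength ρ t)
include hpts hlen

/-- If `t ≠ 0`, the isometry `ρ(s)` exchanges the distinguished points: it conjugates the
isometries `ρ(g(l,0))` to their inverses, hence exchanges their attracting and repelling points. -/
theorem sElt_swaps (ht : t ≠ 0) : (ρ (toPSU sElt)).1 (pt1 M) = pt2 M ∧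
    (ρ (toPSU sElt)).1 (pt2 M) = pt1 M := by
  obtain ⟨S, hS, hxS⟩ := exists_UQ (ρ (toPSU sElt))
  have h2' : (0 : ℝ) < 2⁻¹ := by norm_num
  obtain ⟨D, hD⟩ := exists_lift hpts 2 two_pos 0
  obtain ⟨D', hD'⟩ := exists_lift hpts 2⁻¹ h2' 0
  have hrel : projPerm (D' * S) = projPerm (S * D) := by
    rw [map_mul, map_mul, hxS, hD.2.1, hD'.2.1, ← Subgroup.coe_mul, ← Subgroup.coe_mul, ← map_mul,
      ← map_mul, ← map_mul, ← map_mul, sElt_mul_diag]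
  -- `ρ(g(2⁻¹,0))Sη_i` is a multiple of `Sη_i`, with a factor of modulus `2^t` or `2^{-t}`
  obtain ⟨a, ha, hSD⟩ := eq_smul_of_projPerm_eq (mul_mem hD'.1 hS) (mul_mem hS hD.1) hrel
  simp only [LinearEquiv.mul_apply] at hSD
  set χ : ℝ := (2⁻¹ : ℝ) ^ t with hχ
  have hχ0 : 0 < χ := Real.rpow_pos_of_pos h2' t
  have hχ1 : χ ≠ 1 := by
    rcases lt_or_gt_of_ne ht with h | h
    · exact (Real.one_lt_rpow_of_pos_of_lt_one_of_neg h2' (by norm_num) h).ne'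
    · exact (Real.rpow_lt_one h2'.le (by norm_num) h).ne
  have h2t : (2 : ℝ) ^ t = χ⁻¹ := by rw [hχ, Real.inv_rpow zero_le_two, inv_inv]
  have hπ0 (l : ℝ) (hl : 0 < l) : unitaryPart ρ l hl 0 0 = 0 := by
    obtain ⟨π, hπ⟩ := exists_unitaryPart hpts l hl 0
    rw [← hπ, map_zero]
  have hπ (u : M) : ‖unitaryPart ρ 2⁻¹ h2' 0 u‖ = ‖u‖ := by
    have : (D' (0, 0, u)).2.1 = 0 := by rw [diag_blocks hpts hlen hD']; simp [diagBlock]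
    rw [unitaryPart, hD'.normLift_eq, norm_eq_of_UQ hD'.1 this]
  have e1 := hSD (eta1 M)
  have e2 := hSD (eta2 M)
  rw [diag_blocks hpts hlen hD', diag_blocks hpts hlen hD] at e1 e2
  have d1 : diagBlock (2 ^ t) (unitaryPart ρ 2 two_pos 0) (eta1 M) =
      (((2 : ℝ) ^ t : ℝ) : ℂ) • eta1 M := by simp [diagBlock, eta1, hπ0]
  have d2 : diagBlock (2 ^ t) (unitaryPart ρ 2 two_pos 0) (eta2 M) =
      (((2 : ℝ) ^ t : ℝ) : ℂ)⁻¹ • eta2 M := by simp [diagBlock, eta2, hπ0]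
  rw [d1, h2t, map_smul, smul_smul] at e1
  rw [d2, h2t, map_smul, smul_smul] at e2
  have n1 : ‖a * ((χ⁻¹ : ℝ) : ℂ)‖ = χ⁻¹ := by
    rw [norm_mul, ha, Complex.norm_real, one_mul, Real.norm_of_nonneg (inv_pos.2 hχ0).le]
  have n2 : ‖a * ((χ⁻¹ : ℝ) : ℂ)⁻¹‖ = χ := by
    rw [norm_mul, ha, norm_inv, Complex.norm_real, one_mul,
      Real.norm_of_nonneg (inv_pos.2 hχ0).le, inv_inv]
  exact ⟨(map_mk_eq_iff hxS _ _).2 ((eigenvector_diagBlock hχ0 hχ1 hπ e1).2 n1),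
    (map_mk_eq_iff hxS _ _).2 ((eigenvector_diagBlock hχ0 hχ1 hπ e2).1 n2)⟩

/-- If `t ≠ 0`, the boundary vectors of the cocycle form an orbit of the representation. -/
theorem isEquivariant_data (ht : t ≠ 0) (g : SU11) :
    IsEquivariant (Kfun ρ) (cocyc ρ) g (ρ (toPSU g)) := by
  induction g using SU11_induction with
  | hmul g h hg hh => rw [map_mul, map_mul]; exact hg.mul hh
  | hP l hl b =>
    rw [gP_eq_unip_mul_diag, map_mul, map_mul]
    obtain ⟨U, hU⟩ := exists_lift hpts 1 one_pos (l * b)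
    obtain ⟨D, hD⟩ := exists_lift hpts l hl 0
    refine IsEquivariant.mul ?_ ?_
    · exact isEquivariant_unip hU.2.1 ⟨1, by rw [unip_eta1 hpts hU, one_smul]⟩
        fun b' => ⟨1, by rw [unip_horoVec hpts hU, one_smul, add_comm]⟩
    · refine isEquivariant_diag hD.2.1 ?_ fun b' => ⟨_, diag_horoVec hpts hlen hD b'⟩
      obtain ⟨r, -, hr⟩ := hD.2.2
      exact ⟨r, hr⟩
  | hs =>
    obtain ⟨h1, h2⟩ := sElt_swaps hpts hlen ht
    obtain ⟨S, hS, hxS⟩ := exists_UQ (ρ (toPSU sElt))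
    have hpt (b : ℝ) : (ρ (toPSU (gP 1 one_pos b))).1 (pt2 M) = Projectivization.mk ℂ
        (horoVec (Kfun ρ) (cocyc ρ) b) (horoVec_ne_zero _ _ _) := by
      obtain ⟨U, hU⟩ := exists_lift hpts 1 one_pos b
      exact (map_mk_eq_iff hU.2.1 _ _).2 ⟨1, by rw [unip_eta2 hpts hU, one_smul]⟩
    refine isEquivariant_sElt hxS ?_ ?_ fun b hb => ?_
    · rw [horoVec_data_zero hpts]
      exact (map_mk_eq_iff hxS eta1_ne_zero eta2_ne_zero).1 h1
    · rw [horoVec_data_zero hpts]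
      exact (map_mk_eq_iff hxS eta2_ne_zero eta1_ne_zero).1 h2
    · refine (map_mk_eq_iff hxS (horoVec_ne_zero _ _ _) (horoVec_ne_zero _ _ _)).1 ?_
      obtain ⟨l, hl, y, hrel⟩ := sElt_unip_sElt b hb
      have h3 := congrArg (fun x => (ρ x).1 (pt1 M)) hrel
      simp only [map_mul, Subgroup.coe_mul, Equiv.Perm.mul_apply] at h3
      rwa [h1, hpts.1 l hl y, h1, hpt, hpt] at h3

/-- If `t ≠ 0`, the cocycle of an irreducible representation is total: the bi-orthogonal of the
boundary vectors is an invariant hyperbolic subspace. -/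
theorem total_of_irreducible [CompleteSpace M] (ht : t ≠ 0) (hirr : IsIrreducibleRep ρ) :
    (Submodule.span ℂ (Set.range (cocyc ρ))).topologicalClosure = ⊤ := by
  -- `O` is the orthogonal of the boundary vectors, and `V` the orthogonal of `O`
  let O : Set (Model M) :=
    {w | ∀ p : ℝ × ℝ, p ≠ 0 → Q w (bdryVec (Kfun ρ) (cocyc ρ) p) = 0}
  let V : Submodule ℂ (Model M) :=
    { carrier := {v | ∀ w ∈ O, Q v w = 0}
      zero_mem' := fun w _ => by simp [Q]
      add_mem' := fun {a b} ha hb w hw => by rw [Q_add_left, ha w hw, hb w hw, add_zero]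
      smul_mem' := fun a v hv w hw => by rw [Q_smul_left, hv w hw, mul_zero] }
  have hmem (p : ℝ × ℝ) (hp : p ≠ 0) : bdryVec (Kfun ρ) (cocyc ρ) p ∈ V := fun w hw => by
    rw [← Q_star, hw p hp, star_zero]
  have hη1 : eta1 M ∈ V := by
    have := hmem (1, 0) (by simp)
    rwa [bdryVec_inf rfl] at this
  have hη2 : eta2 M ∈ V := by
    have := hmem (0, 1) (by simp)
    rwa [bdryVec_one_right, horoVec_data_zero hpts] at this
  have hhyp : IsHyperbolicSubspace V := by
    refine ⟨?_, eta1 M + eta2 M, add_mem hη1 hη2, by simp [Q, eta1, eta2]⟩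
    have : (V : Set (Model M)) = ⋂ w ∈ O, {v | Q v w = 0} := by
      ext v
      simp only [Set.mem_iInter]
      rfl
    rw [this]
    refine isClosed_biInter fun w _ => isClosed_eq ?_ continuous_const
    exact continuous_Q.comp (continuous_id.prodMk continuous_const)
  have htop : V = ⊤ := by
    refine hirr.2 V hhyp fun g p _ hpV => ?_
    obtain ⟨g, rfl⟩ := QuotientGroup.mk_surjective g
    induction p using Projectivization.ind with
    | h v hv =>
    obtain ⟨S, hS, hxS⟩ := exists_UQ (ρ (toPSU g))
    rw [rep_mk_mem_iff] at hpV
    refine (rep_map_mem_iff hxS hv V).2 fun w hw => ?_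
    rw [UQ_symm hS]
    refine hpV _ fun q hq => ?_
    obtain ⟨a, ha⟩ := (isEquivariant_data hpts hlen ht g).exists_smul hxS hq
    rw [← UQ_apply hS, LinearEquiv.apply_symm_apply, ha, Q_smul_right,
      hw _ (bdryAct_ne_zero g hq), mul_zero]
  rw [Submodule.topologicalClosure_eq_top_iff, Submodule.eq_bot_iff]
  intro u hu
  have hu' (b : ℝ) : inner ℂ (cocyc ρ b) u = 0 :=
    (Submodule.mem_orthogonal _ u).1 hu _ (Submodule.subset_span ⟨b, rfl⟩)
  have hO : ((0, 0, u) : Model M) ∈ O := by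
    intro p _
    by_cases hp2 : p.2 = 0
    · rw [bdryVec_inf hp2, Q_eta1_right]
    · rw [bdryVec_fin hp2, Q, horoVec]
      simp [hu']
  have hV : ((0, 0, u) : Model M) ∈ V := htop ▸ Submodule.mem_top
  have := hV _ hO
  simpa [Q] using this

omit hpts hlen in
/-- The reversed Cauchy–Schwarz inequality for `w` and `η₁ + η₂`. -/
theorem two_mul_Q_self_le (w : Model M) : 2 * (Q w w).re ≤ Complex.normSq (w.1 + w.2.1) := by
  rw [Q_self, Complex.ofReal_re, Complex.normSq_add, Complex.star_def]
  have h1 := Complex.normSq_nonneg (w.1 - w.2.1)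
  rw [Complex.normSq_sub] at h1
  nlinarith [sq_nonneg ‖w.2.2‖]

omit hpts hlen in
/-- The case of equality in `two_mul_Q_self_le`. -/
theorem eq_smul_of_normSq_le (w : Model M)
    (h : Complex.normSq (w.1 + w.2.1) ≤ 2 * (Q w w).re) : w = w.1 • (eta1 M + eta2 M) := by
  rw [Q_self, Complex.ofReal_re, Complex.normSq_add, Complex.star_def] at h
  have h1 := Complex.normSq_nonneg (w.1 - w.2.1)
  have h3 := Complex.normSq_sub w.1 w.2.1
  have h2 : ‖w.2.2‖ ^ 2 = 0 := le_antisymm (by nlinarith) (sq_nonneg _)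
  have h4 : Complex.normSq (w.1 - w.2.1) = 0 := le_antisymm (by nlinarith) h1
  have h5 : w.1 = w.2.1 := sub_eq_zero.1 (Complex.normSq_eq_zero.1 h4)
  have h6 : w.2.2 = 0 := by simpa using h2
  exact Prod.ext (by simp [eta1, eta2])
    (Prod.ext (by simp [eta1, eta2, h5]) (by simp [eta1, eta2, h6]))

omit hpts hlen in
theorem continuous_of_entry {X : Type*} [TopologicalSpace X] {f : X → SU11}
    (hf : ∀ i j, Continuous fun x => entry (f x) i j) : Continuous f := by
  refine Continuous.subtype_mk (f := fun x => (f x).1) ?_ fun x => (f x).2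
  refine Continuous.subtype_mk (f := fun x => (f x).1.1) ?_ fun x => (f x).1.2
  exact continuous_matrix hf

omit hpts hlen in
theorem continuous_unip : Continuous fun b : ℝ => gP 1 one_pos b := by
  refine continuous_of_entry fun i j => ?_
  fin_cases i <;> fin_cases j <;> simp <;> fun_prop

omit hpts hlen in
theorem continuous_toPSU : Continuous toPSU := QuotientGroup.continuous_mk

omit hpts hlen in
theorem base_pos : 0 < (Q (eta1 M + eta2 M) (eta1 M + eta2 M)).re := by
  simp [Q, eta1, eta2]

omit hpts hlen in
theorem Q_base : Q (eta1 M + eta2 M) (eta1 M + eta2 M) = 2 := by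
  simp [Q, eta1, eta2]
  norm_num

omit hpts hlen in
theorem Q_base_right (w : Model M) : Q w (eta1 M + eta2 M) = w.1 + w.2.1 := by
  simp [Q, eta1, eta2]

omit hlen in
/-- Orbital continuity at `[η₁ + η₂]` forces `K(b) → 0` as `b → 0`. -/
theorem tendsto_Kfun (hcont : OrbContinuous ρ) :
    Filter.Tendsto (fun b => ‖Kfun ρ b‖) (𝓝 0) (𝓝 0) := by
  have h1 := hcont _ ((mk_mem_hypSpace (positive_ne_zero (base_pos (M := M)))).2 base_pos) 1
  have h2 : Filter.Tendsto (fun b : ℝ => toPSU (gP 1 one_pos b)) (𝓝 0) (𝓝 1) :=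
    (continuous_toPSU.comp continuous_unip).tendsto' 0 1 (by simp [gP_one_zero])
  have h3 : ∀ b, hypDist ((ρ (toPSU (gP 1 one_pos b))).1 (Projectivization.mk ℂ _
      (positive_ne_zero (base_pos (M := M))))) ((ρ 1).1 (Projectivization.mk ℂ _
      (positive_ne_zero (base_pos (M := M))))) = Real.arcosh (‖2 + Kfun ρ b‖ / 2) := by
    intro b
    obtain ⟨U, hU⟩ := exists_lift hpts 1 one_pos b
    rw [hypDist_map_map (S' := 1) hU.1 (one_mem _) hU.2.1 (by rw [map_one, map_one]; rfl) base_pos,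
      Q_base]
    have e : Q (U (eta1 M + eta2 M)) ((1 : Model M ≃ₗ[ℂ] Model M) (eta1 M + eta2 M)) =
        2 + Kfun ρ b := by
      rw [LinearEquiv.coe_one, id, Q_base_right, map_add, unip_eta1 hpts hU, unip_eta2 hpts hU]
      simp [eta1, horoVec]
      ring
    rw [e]
    norm_num
  have h4 : Filter.Tendsto (fun b => Real.arcosh (‖2 + Kfun ρ b‖ / 2)) (𝓝 0) (𝓝 0) :=
    (h1.comp h2).congr h3
  have hsq (b : ℝ) : 4 + ‖Kfun ρ b‖ ^ 2 ≤ ‖2 + Kfun ρ b‖ ^ 2 := by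
    have hre : 0 ≤ (Kfun ρ b).re := by rw [Kfun_re]; positivity
    rw [Complex.sq_norm, Complex.sq_norm, Complex.normSq_apply, Complex.normSq_apply]
    simp
    nlinarith
  have hone (b : ℝ) : 1 ≤ ‖2 + Kfun ρ b‖ / 2 := by
    nlinarith [hsq b, sq_nonneg ‖Kfun ρ b‖, norm_nonneg (2 + Kfun ρ b)]
  have h5 : Filter.Tendsto (fun b => ‖2 + Kfun ρ b‖ / 2) (𝓝 0) (𝓝 1) := by
    have := (Real.continuous_cosh.tendsto' 0 1 (by simp)).comp h4
    exact this.congr fun b => Real.cosh_arcosh (hone b)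
  have h6 : Filter.Tendsto (fun b => √(4 * (‖2 + Kfun ρ b‖ / 2) ^ 2 - 4)) (𝓝 0) (𝓝 0) := by
    have : Continuous fun x : ℝ => √(4 * x ^ 2 - 4) := by fun_prop
    exact (this.tendsto' 1 0 (by simp)).comp h5
  refine squeeze_zero (fun b => norm_nonneg _) (fun b => ?_) h6
  apply Real.le_sqrt_of_sq_le
  linarith [hsq b]

/-- If `t ≤ 0`, the homogeneity of `K` prevents `K(b) → 0` as `b → 0` unless `K = 0`. -/
theorem Kfun_eq_zero_of_nonpos (hcont : OrbContinuous ρ) (ht : t ≤ 0) (b : ℝ) : Kfun ρ b = 0 := by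
  have h1 : Filter.Tendsto (fun l : ℝ => ‖Kfun ρ (l ^ 2 * b)‖) (𝓝[>] 0) (𝓝 0) := by
    have h2 : Continuous fun l : ℝ => l ^ 2 * b := by fun_prop
    exact ((tendsto_Kfun hpts hcont).comp (h2.tendsto' 0 0 (by simp))).mono_left
      nhdsWithin_le_nhds
  have h3 : ‖Kfun ρ b‖ ≤ 0 := by
    refine ge_of_tendsto h1 ?_
    filter_upwards [Ioo_mem_nhdsGT one_pos] with l hl
    have h4 : 1 ≤ l ^ t := Real.one_le_rpow_of_pos_of_le_one_of_nonpos hl.1 hl.2.le ht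
    rw [Kfun_sq_mul hpts hlen hl.1, norm_mul, norm_pow, Complex.norm_real,
      Real.norm_of_nonneg (by linarith)]
    have h5 : 1 ≤ (l ^ t) ^ 2 := one_le_pow₀ h4
    nlinarith [norm_nonneg (Kfun ρ b)]
  simpa using h3

omit hpts hlen in
theorem cocyc_eq_zero_of_re {b : ℝ} (h : (Kfun ρ b).re = 0) : cocyc ρ b = 0 := by
  rw [Kfun_re] at h
  simpa using h

/-- If `t = 0`, the subgroup `P` fixes `[η₁ + η₂]`. Since the identity is a limit of elements
of the double coset `PsP`, so does `ρ(s)`, and the representation has a fixed point. -/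
theorem length_ne_zero (hcont : OrbContinuous ρ) (hel : NonElementary ρ) : t ≠ 0 := by
  rintro rfl
  have hK := Kfun_eq_zero_of_nonpos hpts hlen hcont le_rfl
  set v : Model M := eta1 M + eta2 M with hv
  have hv0 : v ≠ 0 := positive_ne_zero base_pos
  set x : ℙ ℂ (Model M) := Projectivization.mk ℂ v hv0 with hx
  have hxmem : x ∈ hypSpace M := (mk_mem_hypSpace hv0).2 base_pos
  have hP (l : ℝ) (hl : 0 < l) (b : ℝ) : (ρ (toPSU (gP l hl b))).1 x = x := by
    obtain ⟨U, hU⟩ := exists_lift hpts 1 one_pos (l * b)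
    obtain ⟨D, hD⟩ := exists_lift hpts l hl 0
    have hDv : D v = v := by
      have h1 : D (eta1 M) = eta1 M := by rw [← hD.normLift_eq, hlen]; simp
      have h2 := diag_horoVec hpts hlen hD 0
      rw [mul_zero, horoVec_data_zero hpts] at h2
      rw [hv, map_add, h1, h2]
      simp
    have hUv : U v = v := by
      rw [hv, map_add, unip_eta1 hpts hU, unip_eta2 hpts hU, horoVec, hK,
        cocyc_eq_zero_of_re (by rw [hK]; rfl)]
      rfl
    have hUx : (ρ (toPSU (gP 1 one_pos (l * b)))).1 x = x :=
      (map_mk_eq_iff hU.2.1 hv0 hv0).2 ⟨1, by rw [hUv, one_smul]⟩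
    have hDx : (ρ (toPSU (gP l hl 0))).1 x = x :=
      (map_mk_eq_iff hD.2.1 hv0 hv0).2 ⟨1, by rw [hDv, one_smul]⟩
    rw [gP_eq_unip_mul_diag, map_mul, map_mul, Subgroup.coe_mul, Equiv.Perm.mul_apply, hDx, hUx]
  obtain ⟨S, hS, hxS⟩ := exists_UQ (ρ (toPSU sElt))
  -- the function `g ↦ d(ρ(g)x, x)` is constant on the double coset
  have hconst (b : ℝ) (hb : b ≠ 0) :
      hypDist ((ρ (toPSU (sElt * gP 1 one_pos b * sElt))).1 x) ((ρ 1).1 x) =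
        hypDist ((ρ (toPSU sElt)).1 x) x := by
    obtain ⟨l, hl, y, hrel⟩ := sElt_unip_sElt b hb
    rw [show toPSU (sElt * gP 1 one_pos b * sElt) =
      toPSU sElt * toPSU (gP 1 one_pos b) * toPSU sElt by rw [map_mul, map_mul], hrel]
    simp only [map_mul, map_one, Subgroup.coe_mul, Subgroup.coe_one, Equiv.Perm.mul_apply,
      Equiv.Perm.coe_one, id]
    rw [hP l hl y]
    nth_rewrite 2 [← hP 1 one_pos (-1 / b)]
    exact hypDist_map _ _ _
  have hlim : Filter.Tendsto (fun b : ℝ => toPSU (sElt * gP 1 one_pos b * sElt)) (𝓝[≠] 0)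
      (𝓝 1) := by
    have h1 : Continuous fun b : ℝ => toPSU (sElt * gP 1 one_pos b * sElt) :=
      continuous_toPSU.comp ((continuous_unip.const_mul sElt).mul_const sElt)
    exact (h1.tendsto' 0 1 (by rw [gP_one_zero, mul_one, toPSU_sElt_sq])).mono_left
      nhdsWithin_le_nhds
  have hzero : hypDist ((ρ (toPSU sElt)).1 x) x = 0 := by
    refine tendsto_nhds_unique (tendsto_const_nhds.congr' ?_) ((hcont x hxmem 1).comp hlim)
    filter_upwards [self_mem_nhdsWithin] with b hb
    exact (hconst b hb).symm
  have hsx : (ρ (toPSU sElt)).1 x = x := by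
    have h1 := hypDist_map_map (y := 1) (S' := 1) hS (one_mem _) hxS (by rw [map_one]; rfl)
      (base_pos (M := M))
    change hypDist ((ρ (toPSU sElt)).1 x) x = _ at h1
    rw [hzero, LinearEquiv.coe_one, id, Q_base_right, Q_base] at h1
    change 0 = Real.arcosh (‖(S v).1 + (S v).2.1‖ / 2) at h1
    have hQ : (Q (S v) (S v)).re = 2 := by rw [UQ_apply hS, hv, Q_base]; rfl
    have h2 := two_mul_Q_self_le (S v)
    have h3 := eq_smul_of_normSq_le (S v)
    rw [hQ, Complex.normSq_eq_norm_sq] at h2 h3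
    have h4 : 1 ≤ ‖(S v).1 + (S v).2.1‖ / 2 := by
      nlinarith [norm_nonneg ((S v).1 + (S v).2.1)]
    have h5 := (Real.arcosh_eq_zero_iff h4).1 h1.symm
    refine (map_mk_eq_iff hxS hv0 hv0).2 ⟨_, h3 ?_⟩
    have : ‖(S v).1 + (S v).2.1‖ = 2 := by linarith
    rw [this]
    norm_num
  refine hel.1 ⟨x, Or.inl hxmem, fun g => ?_⟩
  obtain ⟨g, rfl⟩ := QuotientGroup.mk_surjective g
  change (ρ (toPSU g)).1 x = x
  induction g using SU11_induction with
  | hmul g h hg hh => rw [map_mul, map_mul, Subgroup.coe_mul, Equiv.Perm.mul_apply, hh, hg]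
  | hP l hl b => exact hP l hl b
  | hs => exact hsx

/-- The parabolic data of an irreducible representation form a horospherical cocycle. -/
theorem isHoroCocycle_cocyc [CompleteSpace M] [Nontrivial M] (hcont : OrbContinuous ρ)
    (hirr : IsIrreducibleRep ρ) : IsHoroCocycle t (Kfun ρ 1) (cocyc ρ) := by
  have ht := length_ne_zero hpts hlen hcont hirr.1
  have htotal := total_of_irreducible hpts hlen ht hirr
  have hne : ∃ b, cocyc ρ b ≠ 0 := by
    by_contra! h
    have h1 : Submodule.span ℂ (Set.range (cocyc ρ)) = ⊥ := by
      rw [Submodule.span_eq_bot]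
      rintro _ ⟨b, rfl⟩
      exact h b
    rw [h1, (Submodule.closed_of_finiteDimensional _).submodule_topologicalClosure_eq] at htotal
    exact bot_ne_top htotal
  obtain ⟨b, hb⟩ := hne
  have hKb : (Kfun ρ b).re ≠ 0 := fun h => hb (cocyc_eq_zero_of_re h)
  refine ⟨?_, ?_, ?_, htotal⟩
  · by_contra h
    exact hKb (by rw [Kfun_eq_zero_of_nonpos hpts hlen hcont (not_lt.1 h)]; rfl)
  · have h1 : 0 ≤ (Kfun ρ 1).re := by rw [Kfun_re]; positivity
    refine lt_of_le_of_ne h1 fun h2 => hKb ?_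
    rw [Kfun_eq_kerK hpts ht hlen, kerK_re, ← h2, mul_zero]
  · intro a b
    rw [← Kfun_eq_kerK hpts ht hlen]
    exact inner_cocyc hpts a b

end Irreducible

/-! ### The combination of two cocycles -/

section Combine

variable {L : Type*} [NormedAddCommGroup L] [InnerProductSpace ℂ L] {ρ₁ ρ₂ : PSU11 →* PUQ L}

theorem combK_eq_add (b : ℝ) : combK ρ₁ ρ₂ b = Kfun ρ₁ b + Kfun ρ₂ b := by
  have : ‖combC ρ₁ ρ₂ b‖ ^ 2 = ‖cocyc ρ₁ b‖ ^ 2 + ‖cocyc ρ₂ b‖ ^ 2 :=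
    WithLp.prod_norm_sq_eq_of_L2 _
  rw [combK, Kfun, Kfun, this]
  push_cast
  ring

theorem span_combC'_total [CompleteSpace L] :
    (Submodule.span ℂ (Set.range (combC' ρ₁ ρ₂))).topologicalClosure = ⊤ := by
  have : CompleteSpace (combSpace ρ₁ ρ₂) :=
    (Submodule.isClosed_topologicalClosure _).completeSpace_coe
  rw [Submodule.topologicalClosure_eq_top_iff, Submodule.eq_bot_iff]
  intro u hu
  have hu' (b : ℝ) : inner ℂ (combC ρ₁ ρ₂ b) (u : WithLp 2 (L × L)) = 0 :=
    (Submodule.mem_orthogonal _ u).1 hu _ (Submodule.subset_span ⟨b, rfl⟩)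
  have h1 : combSpace ρ₁ ρ₂ ≤ (Submodule.span ℂ {(u : WithLp 2 (L × L))})ᗮ := by
    refine Submodule.topologicalClosure_minimal _ ?_ (Submodule.isClosed_orthogonal _)
    rw [Submodule.span_le]
    rintro _ ⟨b, rfl⟩
    rw [SetLike.mem_coe, Submodule.mem_orthogonal_singleton_iff_inner_left]
    exact hu' b
  have h2 := (Submodule.mem_orthogonal_singleton_iff_inner_left).1 (h1 u.2)
  exact Subtype.ext (inner_self_eq_zero.1 h2)

theorem isHoroCocycle_combC' [CompleteSpace L] {t : ℝ} {κ₁ κ₂ : ℂ}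
    (h₁ : IsHoroCocycle t κ₁ (cocyc ρ₁)) (h₂ : IsHoroCocycle t κ₂ (cocyc ρ₂)) :
    IsHoroCocycle t (κ₁ + κ₂) (combC' ρ₁ ρ₂) where
  t_pos := h₁.t_pos
  re_pos := add_pos h₁.re_pos h₂.re_pos
  gram a b := by
    have : inner ℂ (combC' ρ₁ ρ₂ b) (combC' ρ₁ ρ₂ a) =
      inner ℂ (cocyc ρ₁ b) (cocyc ρ₁ a) + inner ℂ (cocyc ρ₂ b) (cocyc ρ₂ a) :=
      WithLp.prod_inner_apply _ _
    rw [this, h₁.gram, h₂.gram, kerK_add, kerK_add, kerK_add]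
    ring
  total := span_combC'_total

/-- The space of the combination is infinite-dimensional because it projects onto a dense subspace
of the space of the first representation. -/
theorem not_finiteDimensional_combSpace (hL : ¬ FiniteDimensional ℂ L)
    (h : (Submodule.span ℂ (Set.range (cocyc ρ₁))).topologicalClosure = ⊤) :
    ¬ FiniteDimensional ℂ (combSpace ρ₁ ρ₂) := by
  intro hfd
  let f : combSpace ρ₁ ρ₂ →ₗ[ℂ] L := LinearMap.fst ℂ L L ∘ₗ
    (WithLp.linearEquiv 2 ℂ (L × L)).toLinearMap ∘ₗ (combSpace ρ₁ ρ₂).subtype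
  have hle : (Submodule.span ℂ (Set.range (cocyc ρ₁))).topologicalClosure ≤ LinearMap.range f := by
    refine Submodule.topologicalClosure_minimal _ ?_ (Submodule.closed_of_finiteDimensional _)
    rw [Submodule.span_le]
    rintro _ ⟨b, rfl⟩
    exact ⟨combC' ρ₁ ρ₂ b, rfl⟩
  rw [h, top_le_iff] at hle
  exact hL (Module.Finite.of_surjective f (LinearMap.range_eq_top.1 hle))

theorem exists_combPi (h₁ : HasDistinguishedPoints ρ₁) (h₂ : HasDistinguishedPoints ρ₂) (l : ℝ)
    (hl : 0 < l) (b : ℝ) : ∃ π : WithLp 2 (L × L) →L[ℂ] WithLp 2 (L × L),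
      ∀ w, π w = combPi ρ₁ ρ₂ l hl b w := by
  obtain ⟨π₁, hπ₁⟩ := exists_unitaryPart h₁ l hl b
  obtain ⟨π₂, hπ₂⟩ := exists_unitaryPart h₂ l hl b
  let e := WithLp.prodContinuousLinearEquiv 2 ℂ L L
  refine ⟨(e.symm : L × L →L[ℂ] WithLp 2 (L × L)).comp ((π₁.prodMap π₂).comp
    (e : WithLp 2 (L × L) →L[ℂ] L × L)), fun w => ?_⟩
  rw [combPi, ← hπ₁, ← hπ₂]
  rfl

/-- A unitary operator of `L'` that agrees with `π(l,b)` on the cocycle is its restriction. -/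
theorem coe_eq_combPi [CompleteSpace L] (h₁ : HasDistinguishedPoints ρ₁)
    (h₂ : HasDistinguishedPoints ρ₂) {l : ℝ} {hl : 0 < l} {b : ℝ}
    {π : combSpace ρ₁ ρ₂ ≃ₗᵢ[ℂ] combSpace ρ₁ ρ₂}
    (h : ∀ a, (π (combC' ρ₁ ρ₂ a) : WithLp 2 (L × L)) = combPi ρ₁ ρ₂ l hl b (combC ρ₁ ρ₂ a))
    (u : combSpace ρ₁ ρ₂) : (π u : WithLp 2 (L × L)) = combPi ρ₁ ρ₂ l hl b u := by
  obtain ⟨q, hq⟩ := exists_combPi h₁ h₂ l hl b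
  have : (combSpace ρ₁ ρ₂).subtypeL.comp (π.toContinuousLinearEquiv :
      combSpace ρ₁ ρ₂ →L[ℂ] combSpace ρ₁ ρ₂) = q.comp (combSpace ρ₁ ρ₂).subtypeL := by
    refine eq_of_eqOn_total (span_combC'_total (ρ₁ := ρ₁) (ρ₂ := ρ₂)) fun a => ?_
    change (π (combC' ρ₁ ρ₂ a) : WithLp 2 (L × L)) = q (combC ρ₁ ρ₂ a)
    rw [h a, hq]
  rw [← hq]
  exact congrArg (fun f : combSpace ρ₁ ρ₂ →L[ℂ] WithLp 2 (L × L) => f u) this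

end Combine

end Horo

theorem mainTheorem3 {L : Type*} [NormedAddCommGroup L] [InnerProductSpace ℂ L]
    [CompleteSpace L] [TopologicalSpace.SeparableSpace L] (hL : ¬ FiniteDimensional ℂ L)
    (t : ℝ) (ρ₁ ρ₂ : PSU11 →* PUQ L)
    (hcont₁ : OrbContinuous ρ₁) (hcont₂ : OrbContinuous ρ₂)
    (hirr₁ : IsIrreducibleRep ρ₁) (hirr₂ : IsIrreducibleRep ρ₂)
    (hpts₁ : HasDistinguishedPoints ρ₁) (hpts₂ : HasDistinguishedPoints ρ₂)
    (hlen₁ : HasLength ρ₁ t) (hlen₂ : HasLength ρ₂ t) :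
    combK ρ₁ ρ₂ 1 ≠ 0 ∧ ¬ FiniteDimensional ℂ (combSpace ρ₁ ρ₂) ∧
    ∃ (A : combSpace ρ₁ ρ₂ ≃ₗᵢ[ℂ] combSpace ρ₁ ρ₂)
      (T : SU11 →* PUQ (combSpace ρ₁ ρ₂)) (ρ : PSU11 →* PUQ (combSpace ρ₁ ρ₂)),
      -- `A` is a unitary involution; the factor `‖K(1)‖⁻¹` is `1` if `‖K(1)‖ = 1`
      (∀ u, A (A u) = u) ∧
      (∀ b : ℝ, b ≠ 0 → A (combC' ρ₁ ρ₂ b) =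
        (((‖combK ρ₁ ρ₂ 1‖⁻¹ : ℝ) : ℂ) * combK ρ₁ ρ₂ b) • combC' ρ₁ ρ₂ (-1 / b)) ∧
      -- `T` extends the combined parabolic data and maps `s` to the isometry given by `A`
      (∀ (l : ℝ) (hl : 0 < l),
        IsRepresentedByRestriction ρ₁ ρ₂ (T (gP l hl 0))
          (diagBlock (l ^ t) (combPi ρ₁ ρ₂ l hl 0))) ∧
      (∀ b : ℝ,
        IsRepresentedByRestriction ρ₁ ρ₂ (T (gP 1 one_pos b))
          (unipBlock (combK ρ₁ ρ₂ b) (combC ρ₁ ρ₂ b) (combPi ρ₁ ρ₂ 1 one_pos b))) ∧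
      IsRepresentedBy (T sElt) (swapBlock ‖combK ρ₁ ρ₂ 1‖⁻¹ A) ∧
      -- `T` induces the representation `ρ`
      (∀ g, ρ (toPSU g) = T g) ∧
      OrbContinuous ρ ∧ IsIrreducibleRep ρ ∧ HasDistinguishedPoints ρ ∧
      HasLength ρ t ∧ angularInvariant ρ = (Kfun ρ₁ 1 + Kfun ρ₂ 1).arg := by
  have : Nontrivial L := not_subsingleton_iff_nontrivial.1 fun _ => hL inferInstance
  have h₁ := isHoroCocycle_cocyc hpts₁ hlen₁ hcont₁ hirr₁
  have h₂ := isHoroCocycle_cocyc hpts₂ hlen₂ hcont₂ hirr₂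
  have h := isHoroCocycle_combC' h₁ h₂
  have : CompleteSpace (combSpace ρ₁ ρ₂) :=
    (Submodule.isClosed_topologicalClosure _).completeSpace_coe
  have hK1 : combK ρ₁ ρ₂ 1 = Kfun ρ₁ 1 + Kfun ρ₂ 1 := combK_eq_add 1
  have hK (b : ℝ) : combK ρ₁ ρ₂ b = kerK t (combK ρ₁ ρ₂ 1) b := by
    rw [hK1, kerK_add, ← Kfun_eq_kerK hpts₁ h.t_pos.ne' hlen₁,
      ← Kfun_eq_kerK hpts₂ h.t_pos.ne' hlen₂, combK_eq_add]
  rw [← hK1] at h ⊢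
  obtain ⟨A, hA⟩ := h.exists_swap
  obtain ⟨ρ, hρ⟩ := h.exists_rep
  refine ⟨h.ne_zero, not_finiteDimensional_combSpace hL h₁.total, A, ρ.comp toPSU, ρ,
    h.swap_involutive hA, fun b _ => by rw [hA, hK b], fun l hl => ?_, fun b => ?_,
    ⟨_, swapEquiv_mem _ _ A, h.swap_lift hρ hA, fun v => rfl⟩, fun g => rfl, h.orbContinuous hρ,
    h.isIrreducibleRep hρ, h.hasDistinguishedPoints hρ, h.hasLength hρ, ?_⟩
  · obtain ⟨π, hπ⟩ := h.exists_diag hl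
    have hS := h.diag_lift hρ (hl := hl) hπ
    have hcoe := coe_eq_combPi (l := l) (hl := hl) (b := 0) hpts₁ hpts₂ (π := π) fun a => by
      rw [hπ, combPi]
      change _ = WithLp.toLp 2 (unitaryPart ρ₁ l hl 0 (cocyc ρ₁ a),
        unitaryPart ρ₂ l hl 0 (cocyc ρ₂ a))
      rw [unitaryPart_diag_cocyc hpts₁ hlen₁, unitaryPart_diag_cocyc hpts₂ hlen₂]
      rfl
    refine ⟨_, ⟨_, hS.1, hS.2.1, fun v => rfl⟩, fun v => ?_⟩
    simp only [diagEquiv_apply, diagBlock, combIncl, hcoe]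
  · obtain ⟨π, hπ⟩ := h.exists_unip b
    have hS := h.unip_lift hρ hπ
    have hcoe := coe_eq_combPi (l := 1) (hl := one_pos) (b := b) hpts₁ hpts₂ (π := π) fun a => by
      rw [hπ, combPi]
      change _ = WithLp.toLp 2 (unitaryPart ρ₁ 1 one_pos b (cocyc ρ₁ a),
        unitaryPart ρ₂ 1 one_pos b (cocyc ρ₂ a))
      rw [unitaryPart_unip_cocyc hpts₁, unitaryPart_unip_cocyc hpts₂]
      rfl
    refine ⟨_, ⟨_, hS.1, hS.2.1, fun v => rfl⟩, fun v => ?_⟩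
    simp only [unipEquiv_apply, unipBlock, combIncl, hK b, Submodule.coe_add, Submodule.coe_smul,
      Submodule.coe_inner, hcoe]
    rfl
  · rw [angularInvariant, h.Kfun_eq hρ, kerK_one]
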